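/- Let $M^3$ be a smooth $3$-manifold, $I\subset\mathbb R$ an interval containing $0$, $g_t$ ($t\in I$) a smooth family of Riemannian metrics on $M^3$ and $U_t$ a smooth family of vector fields with $g_t(U_t,U_t)=1$. Let $\mathcal G=-dt^2+g_t$ be the associated space-time metric on $I\times M^3$, with curvature ${}^{\mathcal G}R(A,B)=\nabla_A\nabla_B-\nabla_B\nabla_A-\nabla_{[A,B]}$. Write $\nabla^g$ and $\mathrm{Ricci}^g$ for the Levi-Civita connection and the Ricci tensor of $g=g_t$, put $\theta=g(U,\cdot)$, $\alpha\odot\beta=\tfrac12(\alpha\otimes\beta+\beta\otimes\alpha)$, $(\mathrm{sym}\,S)(A,B)=\tfrac12(S(A,B)+S(B,A))$, and $$\mathcal R=-\mathrm{Ricci}^g+\mathrm{sym}\,\mathcal G({}^{\mathcal G}R(\partial_t,\cdot)U,\cdot).$$ For local vector fields $X,Y$ such that $X,Y,U$ is an orthonormal frame of $(M^3,g_t)$, and $Z=X-iY$, let $\rho=g(\nabla^g_{\bar Z}U,Z)$ and let $\nu=g(U,\nabla^g_XX+\nabla^g_YY)=-\mathrm{Re}\,\rho$ be the mean curvature of the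 distribution $U^\perp$. Suppose that on $I\times M^3$ $$\text{(i)}\quad\frac{\partial U}{\partial t}=-\nabla^g_UU,$$ and that, wherever $\nu\neq0$, $$\text{(ii)}\quad\frac{\partial g}{\partial t}=-\frac4\nu\left\{\mathcal R-2\,\mathcal R(U,\cdot)\odot\theta+\mathcal R(U,U)\,\theta^2\right\}.$$ (a) Suppose that $U_0$ is tangent to a conformal foliation of $(M^3,g_0)$, i.e. there is a function $a$ with $(\mathcal L_{U_0}g_0)(X,Y)=a\,g_0(X,Y)$ for all vector fields $X,Y$ orthogonal to $U_0$, and that the complementary distribution $U_0^\perp$ is integrable, i.e. closed under Lie brackets. Let $t\in I$, $t\ge0$, be such that $\rho$ vanishes nowhere on $[0,t]\times M^3$, and let $M_t\subset M^3$ be the set of those $x$ for which the integral curve of $\partial_t+U$ ending at $(t,x)$ can be followed back to the initial slice $\{0\}\times M^3$. Then on $M_t$ the vector field $U_t$ is tangent to a conformal foliation with respect to $g_t$, and $U_t^\perp$ is integrable on $M_t$. In particular, both properties hold on all of $M^3$ if every integral curve can be followed back to the initial slice, that is, if $M_t=M^3$. (b) Every integral curve of the vector field $\partial_t+U$ in $I\times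 M^3$, defined on an open set of parameters and along which $\nu\ne0$, is a null geodesic of $\mathcal G$. -/

import Mathlib

open scoped Manifold ContDiff Topology
open Set

noncomputable section

namespace NullFlow

/-! ### Pseudo-Riemannian geometry in coordinates

A metric on an open part of a vector space `F` (the range of a chart) is a map
`G : F → F →L[ℝ] F →L[ℝ] ℝ`. -/

section Coordinates

variable {F : Type*} [NormedAddCommGroup F] [NormedSpace ℝ F]

/-- The Christoffel symbols `Γ(v, w)` of `G` at `p`:
`G(Γ(v, w), z) = (D_v G(w, z) + D_w G(v, z) - D_z G(v, w)) / 2` for all `z`. -/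
def christoffel (G : F → F →L[ℝ] F →L[ℝ] ℝ) (p v w : F) : F :=
  (G p).inverse ((1 / 2 : ℝ) •
    (fderiv ℝ G p v w + fderiv ℝ G p w v - ((fderiv ℝ G p).flip v).flip w))

/-- The Levi-Civita covariant derivative `∇_v W` at `p` of the vector field `W`. -/
def cov (G : F → F →L[ℝ] F →L[ℝ] ℝ) (W : F → F) (p v : F) : F :=
  fderiv ℝ W p v + christoffel G p v (W p)

/-- The curvature `R(v, w)z = ∇_v ∇_w z - ∇_w ∇_v z - ∇_[v, w] z` of `G` at `p`. -/
def curvature (G : F → F →L[ℝ] F →L[ℝ] ℝ) (p v w z : F) : F :=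
  fderiv ℝ (fun q => christoffel G q w z) p v - fderiv ℝ (fun q => christoffel G q v z) p w
    + christoffel G p v (christoffel G p w z) - christoffel G p w (christoffel G p v z)

theorem apply_christoffel (G : F → F →L[ℝ] F →L[ℝ] ℝ) (p v w z : F) (hG : (G p).IsInvertible) :
    G p (christoffel G p v w) z
      = (1 / 2) * (fderiv ℝ G p v w z + fderiv ℝ G p w v z - fderiv ℝ G p z v w) := by
  obtain ⟨e, he⟩ := hG
  simp [christoffel, ← he]

theorem inner_cov_self (G : F → F →L[ℝ] F →L[ℝ] ℝ) (W X : F → F) (p : F)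
    (hG : DifferentiableAt ℝ G p) (hW : DifferentiableAt ℝ W p) (hX : DifferentiableAt ℝ X p)
    (hsymm : ∀ q v w, G q v w = G q w v) (hinv : (G p).IsInvertible)
    (h : ∀ᶠ q in 𝓝 p, G q (W q) (X q) = 0) :
    G p (W p) (cov G X p (X p)) = - G p (cov G W p (X p)) (X p) := by
  have hd := ((hG.hasFDerivAt.clm_apply hW.hasFDerivAt).clm_apply hX.hasFDerivAt).congr_of_eventuallyEq
    (f₁ := fun _ => (0 : ℝ)) (h.mono fun q hq => hq.symm)
  have h0 := congrArg (fun L : F →L[ℝ] ℝ => L (X p)) (hd.unique (hasFDerivAt_const (0 : ℝ) p))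
  have hs : ∀ a v w : F, fderiv ℝ G p a v w = fderiv ℝ G p a w v := by
    intro a v w
    have h1 := (hG.hasFDerivAt.clm_apply (hasFDerivAt_const v p)).clm_apply (hasFDerivAt_const w p)
    have h2 := (hG.hasFDerivAt.clm_apply (hasFDerivAt_const w p)).clm_apply (hasFDerivAt_const v p)
    have h3 := h1.unique (h2.congr_of_eventuallyEq (.of_forall fun q => hsymm q v w))
    simpa using congrArg (fun L : F →L[ℝ] ℝ => L a) h3
  simp only [add_apply, ContinuousLinearMap.comp_apply,
    ContinuousLinearMap.flip_apply, zero_apply] at h0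
  simp only [cov, map_add, add_apply]
  rw [hsymm p (W p) (christoffel G p (X p) (X p)), apply_christoffel G p _ _ _ hinv,
    apply_christoffel G p _ _ _ hinv]
  have := hs (X p) (X p) (W p)
  linarith

end Coordinates

/-- The model space of a `3`-manifold. -/
abbrev E3 : Type := EuclideanSpace ℝ (Fin 3)

/-- The Ricci tensor: the trace of `z ↦ R(z, v)w`. -/
def ricci (g : E3 → E3 →L[ℝ] E3 →L[ℝ] ℝ) (y v w : E3) : ℝ :=
  ∑ i : Fin 3, (curvature g y (EuclideanSpace.single i 1) v w) i

/-- `X`, `Y` complete the unit vector `u` to an orthonormal basis with respect to `b`. -/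
structure IsComplementaryFrame (b : E3 →L[ℝ] E3 →L[ℝ] ℝ) (u X Y : E3) : Prop where
  norm_X : b X X = 1
  norm_Y : b Y Y = 1
  orth_XY : b X Y = 0
  orth_uX : b u X = 0
  orth_uY : b u Y = 0

/-- `ρ = g(∇_{Z̄} u, Z)`, with `Z = X - iY` and `g`, `∇` extended complex-linearly. -/
def rho (g : E3 → E3 →L[ℝ] E3 →L[ℝ] ℝ) (u : E3 → E3) (y X Y : E3) : ℂ :=
  ((g y (cov g u y X) X + g y (cov g u y Y) Y : ℝ) : ℂ)
    + ((g y (cov g u y Y) X - g y (cov g u y X) Y : ℝ) : ℂ) * Complex.I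

/-- The mean curvature `ν = g(u, ∇_X X + ∇_Y Y)` of the distribution `u^⊥`. For fields `X`
orthogonal to `u` one has `g(u, ∇_X X) = - g(∇_X u, X)` (see `inner_cov_self`), which only involves
the value of `X` at the point. -/
def nu (g : E3 → E3 →L[ℝ] E3 →L[ℝ] ℝ) (u : E3 → E3) (y X Y : E3) : ℝ :=
  -(g y (cov g u y X) X + g y (cov g u y Y) Y)

/-- The space-time metric `- dt² + g_t` in the coordinates `(t, y)`. -/
def spacetime (g : ℝ × E3 → E3 →L[ℝ] E3 →L[ℝ] ℝ) (p : ℝ × E3) :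
    (ℝ × E3) →L[ℝ] (ℝ × E3) →L[ℝ] ℝ :=
  (g p).bilinearComp (ContinuousLinearMap.snd ℝ ℝ E3) (ContinuousLinearMap.snd ℝ ℝ E3)
    - (ContinuousLinearMap.mul ℝ ℝ).bilinearComp
        (ContinuousLinearMap.fst ℝ ℝ E3) (ContinuousLinearMap.fst ℝ ℝ E3)

/-- The `2`-tensor `G(R(∂_t, v)U, w)`, with `R` the curvature of the space-time metric `G`. -/
def mixedCurvature (g : ℝ × E3 → E3 →L[ℝ] E3 →L[ℝ] ℝ) (u : ℝ × E3 → E3) (p : ℝ × E3)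
    (v w : E3) : ℝ :=
  spacetime g p (curvature (spacetime g) p (1, 0) (0, v) (0, u p)) (0, w)

/-- The symmetric tensor `𝓡 = - Ricci + sym G(R(∂_t, ·)U, ·)` on the slice of constant time. -/
def curvR (g : ℝ × E3 → E3 →L[ℝ] E3 →L[ℝ] ℝ) (u : ℝ × E3 → E3) (p : ℝ × E3) (v w : E3) : ℝ :=
  - ricci (fun y => g (p.1, y)) p.2 v w
    + (1 / 2) * (mixedCurvature g u p v w + mixedCurvature g u p w v)

/-- The tensor `𝓡 - 2 𝓡(U, ·) ⊙ θ + 𝓡(U, U) θ²`, with `θ = g(U, ·)` and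
`α ⊙ β = (α ⊗ β + β ⊗ α) / 2`. -/
def curvRPerp (g : ℝ × E3 → E3 →L[ℝ] E3 →L[ℝ] ℝ) (u : ℝ × E3 → E3) (p : ℝ × E3) (v w : E3) :
    ℝ :=
  curvR g u p v w
    - (curvR g u p (u p) v * g p (u p) w + curvR g u p (u p) w * g p (u p) v)
    + curvR g u p (u p) (u p) * (g p (u p) v * g p (u p) w)

/-! ### Evolving metrics and vector fields on a `3`-manifold -/

variable {M : Type*} [TopologicalSpace M] [ChartedSpace E3 M]

/-- The metrics `g_t` read in the chart `φ`, as a function of `(t, y)`. -/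
def metricIn (g : ℝ → Bundle.RiemannianMetric (fun x : M => TangentSpace (𝓡 3) x))
    (φ : OpenPartialHomeomorph M E3) (p : ℝ × E3) : E3 →L[ℝ] E3 →L[ℝ] ℝ :=
  let A : E3 →L[ℝ] E3 := mfderiv (𝓡 3) (𝓡 3) φ.symm p.2
  ContinuousLinearMap.bilinearComp
    (show E3 →L[ℝ] E3 →L[ℝ] ℝ from (g p.1).inner (φ.symm p.2)) A A

/-- The vector fields `U_t` read in the chart `φ`, as a function of `(t, y)`. -/
def fieldIn (U : ℝ → (x : M) → TangentSpace (𝓡 3) x)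
    (φ : OpenPartialHomeomorph M E3) (p : ℝ × E3) : E3 :=
  mfderiv (𝓡 3) (𝓡 3) φ (φ.symm p.2) (U p.1 (φ.symm p.2))

/-- A smooth evolving triple `(M, g_t, U_t)`, `t ∈ I`, with `U_t` a unit vector field. At an end
point of `I` that belongs to `I`, smoothness means that `g` and `U` are smooth beyond this point;
what they are at times outside `I` plays no other role. -/
structure IsEvolvingTriple (I : Set ℝ)
    (g : ℝ → Bundle.RiemannianMetric (fun x : M => TangentSpace (𝓡 3) x))
    (U : ℝ → (x : M) → TangentSpace (𝓡 3) x) : Prop where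
  smooth_metric : ∀ φ ∈ IsManifold.maximalAtlas (𝓡 3) ∞ M, ∀ t ∈ I, ∀ y ∈ φ.target,
    ContDiffAt ℝ ∞ (metricIn g φ) (t, y)
  smooth_field : ∀ φ ∈ IsManifold.maximalAtlas (𝓡 3) ∞ M, ∀ t ∈ I, ∀ y ∈ φ.target,
    ContDiffAt ℝ ∞ (fieldIn U φ) (t, y)
  unit : ∀ t ∈ I, ∀ x : M, (g t).inner x (U t x) (U t x) = 1

/-- `ρ` is non-zero at `(t, x)`. The value of `ρ` does not depend on the chart, and a change of the
complementary frame changes it at most into its complex conjugate. -/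
def RhoNeZero (g : ℝ → Bundle.RiemannianMetric (fun x : M => TangentSpace (𝓡 3) x))
    (U : ℝ → (x : M) → TangentSpace (𝓡 3) x) (t : ℝ) (x : M) : Prop :=
  ∀ φ ∈ IsManifold.maximalAtlas (𝓡 3) ∞ M, x ∈ φ.source → ∀ X Y : E3,
    IsComplementaryFrame (metricIn g φ (t, φ x)) (fieldIn U φ (t, φ x)) X Y →
      rho (fun y => metricIn g φ (t, y)) (fun y => fieldIn U φ (t, y)) (φ x) X Y ≠ 0

/-- The mean curvature `ν` of `U_t^⊥` is non-zero at `(t, x)`. Its value depends neither on the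
chart nor on the complementary frame. -/
def NuNeZero (g : ℝ → Bundle.RiemannianMetric (fun x : M => TangentSpace (𝓡 3) x))
    (U : ℝ → (x : M) → TangentSpace (𝓡 3) x) (t : ℝ) (x : M) : Prop :=
  ∀ φ ∈ IsManifold.maximalAtlas (𝓡 3) ∞ M, x ∈ φ.source → ∀ X Y : E3,
    IsComplementaryFrame (metricIn g φ (t, φ x)) (fieldIn U φ (t, φ x)) X Y →
      nu (fun y => metricIn g φ (t, y)) (fun y => fieldIn U φ (t, y)) (φ x) X Y ≠ 0

/-- The evolution equations, in all charts:
`∂U/∂t = - ∇_U U` and `∂g/∂t = - (4 / ν) {𝓡 - 2 𝓡(U, ·) ⊙ θ + 𝓡(U, U) θ²}`.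
The second one is imposed wherever it makes sense, that is, wherever `ν ≠ 0`. -/
structure IsModifiedRicciFlow (I : Set ℝ)
    (g : ℝ → Bundle.RiemannianMetric (fun x : M => TangentSpace (𝓡 3) x))
    (U : ℝ → (x : M) → TangentSpace (𝓡 3) x) : Prop where
  field_eq : ∀ φ ∈ IsManifold.maximalAtlas (𝓡 3) ∞ M, ∀ t ∈ I, ∀ y ∈ φ.target,
    deriv (fun s => fieldIn U φ (s, y)) t
      = - cov (fun z => metricIn g φ (t, z)) (fun z => fieldIn U φ (t, z)) y (fieldIn U φ (t, y))
  metric_eq : ∀ φ ∈ IsManifold.maximalAtlas (𝓡 3) ∞ M, ∀ t ∈ I, ∀ y ∈ φ.target, ∀ X Y : E3,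
    IsComplementaryFrame (metricIn g φ (t, y)) (fieldIn U φ (t, y)) X Y →
    nu (fun z => metricIn g φ (t, z)) (fun z => fieldIn U φ (t, z)) y X Y ≠ 0 →
    ∀ v w : E3, deriv (fun s => metricIn g φ (s, y) v w) t
      = - (4 / nu (fun z => metricIn g φ (t, z)) (fun z => fieldIn U φ (t, z)) y X Y)
          * curvRPerp (metricIn g φ) (fieldIn U φ) (t, y) v w

/-- `X` is a smooth vector field near `x`, orthogonal to `U`. -/
def IsHorizontalNear (g : Bundle.RiemannianMetric (fun x : M => TangentSpace (𝓡 3) x))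
    (U X : (x : M) → TangentSpace (𝓡 3) x) (x : M) [IsManifold (𝓡 3) ∞ M] : Prop :=
  ContMDiffAt (𝓡 3) (𝓡 3).tangent ∞ (fun z => (⟨z, X z⟩ : TangentBundle (𝓡 3) M)) x ∧
    ∀ᶠ z in 𝓝 x, g.inner z (U z) (X z) = 0

/-- The Lie derivative `(L_U g)(X, Y) = U(g(X, Y)) - g([U, X], Y) - g(X, [U, Y])` at `x`. -/
def lieDerivMetric (g : Bundle.RiemannianMetric (fun x : M => TangentSpace (𝓡 3) x))
    (U X Y : (x : M) → TangentSpace (𝓡 3) x) (x : M) : ℝ :=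
  (show ℝ from mfderiv (𝓡 3) 𝓘(ℝ, ℝ) (fun z => g.inner z (X z) (Y z)) x (U x))
    - g.inner x (VectorField.mlieBracket (𝓡 3) U X x) (Y x)
    - g.inner x (X x) (VectorField.mlieBracket (𝓡 3) U Y x)

/-- On the set `V` the vector field `U` is tangent to a conformal foliation of `(M, g)`: there is a
function `a` with `(L_U g)(X, Y) = a g(X, Y)` for all `X`, `Y` orthogonal to `U`. -/
def IsConformalFoliationOn (g : Bundle.RiemannianMetric (fun x : M => TangentSpace (𝓡 3) x))
    (U : (x : M) → TangentSpace (𝓡 3) x) (V : Set M) [IsManifold (𝓡 3) ∞ M] : Prop :=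
  ∃ a : M → ℝ, ∀ x ∈ V, ∀ X Y : (x : M) → TangentSpace (𝓡 3) x,
    IsHorizontalNear g U X x → IsHorizontalNear g U Y x →
      lieDerivMetric g U X Y x = a x * g.inner x (X x) (Y x)

/-- On the set `V` the distribution `U^⊥` is integrable: it is closed under Lie brackets. -/
def IsIntegrableComplementOn
    (g : Bundle.RiemannianMetric (fun x : M => TangentSpace (𝓡 3) x))
    (U : (x : M) → TangentSpace (𝓡 3) x) (V : Set M) [IsManifold (𝓡 3) ∞ M] : Prop :=
  ∀ x ∈ V, ∀ X Y : (x : M) → TangentSpace (𝓡 3) x,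
    IsHorizontalNear g U X x → IsHorizontalNear g U Y x →
      g.inner x (U x) (VectorField.mlieBracket (𝓡 3) X Y x) = 0

/-- The vector field `∂_t + U` on `ℝ × M`. -/
def nullField (U : ℝ → (x : M) → TangentSpace (𝓡 3) x) (p : ℝ × M) :
    TangentSpace (𝓘(ℝ, ℝ).prod (𝓡 3)) p :=
  ((1 : ℝ), (U p.1 p.2 : E3))

/-- The points `x` such that the integral curve of `∂_t + U` that ends at `(t, x)` can be followed
back to the initial slice `{0} × M`. -/
def reached (U : ℝ → (x : M) → TangentSpace (𝓡 3) x) (t : ℝ) : Set M :=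
  {x | ∃ γ : ℝ → ℝ × M, IsMIntegralCurveOn (I := 𝓘(ℝ, ℝ).prod (𝓡 3)) γ (nullField U) (Icc 0 t) ∧
    (γ 0).1 = 0 ∧ γ t = (t, x)}

/-- On the open set `J` the curve `γ` in `ℝ × M` is a null geodesic of `- dt² + g_t`: in charts
`c'' + Γ(c', c') = 0` and `c'` is null and non-zero. -/
def IsNullGeodesicOn (g : ℝ → Bundle.RiemannianMetric (fun x : M => TangentSpace (𝓡 3) x))
    (γ : ℝ → ℝ × M) (J : Set ℝ) : Prop :=
  ContinuousOn γ J ∧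
  ∀ φ ∈ IsManifold.maximalAtlas (𝓡 3) ∞ M, ∀ s ∈ J, (γ s).2 ∈ φ.source →
    let c : ℝ → ℝ × E3 := fun r => ((γ r).1, φ (γ r).2)
    ContDiffAt ℝ 2 c s ∧
      deriv (deriv c) s
        + christoffel (spacetime (metricIn g φ)) (c s) (deriv c s) (deriv c s) = 0 ∧
      spacetime (metricIn g φ) (c s) (deriv c s) (deriv c s) = 0 ∧ deriv c s ≠ 0

end NullFlow

end

/-!
The geometry of `U^⊥` is recorded by the shape tensor `S(v, w) = g(∇_v U, w)` on `U^⊥`. The Lie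
derivative of `g` along `U` is the symmetrisation of `S` and the brackets of horizontal fields see
its antisymmetric part, so "conformal with integrable complement" says that `S` is umbilic: shear
and twist vanish. Along the integral curves of `∂_t + U` the tensor `S` satisfies a Riccati
equation. In dimension three the horizontal part of `R(·, U)U` differs from the horizontal Ricci
tensor by a multiple of `g`, so equation (ii) is exactly what makes the curvature terms of the
Riccati equation pure trace. Shear and twist then solve a homogeneous linear system, and by
Grönwall's inequality the set of parameters at which they vanish is open to the right; it is closed
by continuity. At an umbilic point `ρ = -ν`, so that (ii) is in force there.

For the second part, (ii) gives `ġ(U, ·) = 0`, which together with (i) is the geodesic equation for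
`∂_t + U`, and this field is null since `g(U, U) = 1`.
-/

noncomputable section

set_option maxSynthPendingDepth 3

namespace NullFlow

section Coordinates

variable {F : Type*} [NormedAddCommGroup F] [NormedSpace ℝ F]
variable {H : Type*} [NormedAddCommGroup H] [NormedSpace ℝ H]
variable {V : Type*} [NormedAddCommGroup V] [NormedSpace ℝ V]

theorem differentiableAt_fderiv {f : H → F} {p : H} (hf : ContDiffAt ℝ 2 f p) :
    DifferentiableAt ℝ (fderiv ℝ f) p :=
  (hf.fderiv_right (m := 1) (by norm_num)).differentiableAt (by norm_num)

theorem fderiv_bilin {G : H → F →L[ℝ] F →L[ℝ] ℝ} {X Y : H → F} {p : H}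
    (hG : DifferentiableAt ℝ G p) (hX : DifferentiableAt ℝ X p) (hY : DifferentiableAt ℝ Y p)
    (a : H) :
    fderiv ℝ (fun q => G q (X q) (Y q)) p a
      = fderiv ℝ G p a (X p) (Y p) + G p (fderiv ℝ X p a) (Y p) + G p (X p) (fderiv ℝ Y p a) := by
  rw [((hG.hasFDerivAt.clm_apply hX.hasFDerivAt).clm_apply hY.hasFDerivAt).fderiv]
  simp only [add_apply, ContinuousLinearMap.comp_apply, ContinuousLinearMap.flip_apply]
  ring

theorem fderiv_apply_const {T : H → F →L[ℝ] V} {p : H} (hT : DifferentiableAt ℝ T p) (a : H)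
    (v : F) : fderiv ℝ (fun q => T q v) p a = fderiv ℝ T p a v := by
  rw [fderiv_clm_apply hT (differentiableAt_const v)]
  simp

theorem fderiv_bilin_apply {T : H → F →L[ℝ] F →L[ℝ] V} {p : H} (hT : DifferentiableAt ℝ T p)
    (a : H) (v w : F) : fderiv ℝ (fun q => T q v w) p a = fderiv ℝ T p a v w := by
  rw [fderiv_apply_const (hT.clm_apply (differentiableAt_const v)), fderiv_apply_const hT]

theorem fderiv_bilin_symm {G : H → F →L[ℝ] F →L[ℝ] ℝ} {p : H} (hG : DifferentiableAt ℝ G p)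
    (hsymm : ∀ q v w, G q v w = G q w v) (a : H) (v w : F) :
    fderiv ℝ G p a v w = fderiv ℝ G p a w v := by
  rw [← fderiv_bilin_apply hG, ← fderiv_bilin_apply hG]
  simp only [hsymm _ v w]

theorem fderiv_fderiv_bilin_apply {G : H → F →L[ℝ] F →L[ℝ] ℝ} {p : H}
    (hG : ContDiffAt ℝ 2 G p) (a b : H) (v w : F) :
    fderiv ℝ (fun q => fderiv ℝ G q b v w) p a = fderiv ℝ (fderiv ℝ G) p a b v w := by
  have hD := differentiableAt_fderiv hG
  rw [fderiv_bilin_apply (hD.clm_apply (differentiableAt_const b)), fderiv_apply_const hD]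

theorem fderiv_fderiv_bilin_symm {G : H → F →L[ℝ] F →L[ℝ] ℝ} {p : H}
    (hG : ContDiffAt ℝ 2 G p) (hsymm : ∀ q v w, G q v w = G q w v) (a b : H) (v w : F) :
    fderiv ℝ (fderiv ℝ G) p a b v w = fderiv ℝ (fderiv ℝ G) p a b w v := by
  rw [← fderiv_fderiv_bilin_apply hG, ← fderiv_fderiv_bilin_apply hG]
  have heq : (fun q => fderiv ℝ G q b v w) =ᶠ[𝓝 p] fun q => fderiv ℝ G q b w v := by
    filter_upwards [hG.eventually (by simp)] with q hq
    exact fderiv_bilin_symm (hq.differentiableAt (by norm_num)) hsymm b v w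
  rw [heq.fderiv_eq]

theorem fderiv_fderiv_swap {f : H → F} {p : H} (hf : ContDiffAt ℝ 2 f p) (a b : H) :
    fderiv ℝ (fderiv ℝ f) p a b = fderiv ℝ (fderiv ℝ f) p b a :=
  hf.isSymmSndFDerivAt (by simp) a b

theorem injective_of_isInvertible {A : F →L[ℝ] F →L[ℝ] ℝ} (hA : A.IsInvertible) {v w : F}
    (h : ∀ z, A v z = A w z) : v = w := by
  obtain ⟨e, rfl⟩ := hA
  exact e.injective (ContinuousLinearMap.ext h)

theorem isInvertible_of_injective [FiniteDimensional ℝ F] (A : F →L[ℝ] F →L[ℝ] ℝ)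
    (hA : ∀ v, (∀ w, A v w = 0) → v = 0) : A.IsInvertible := by
  have hinj : Function.Injective (A : F →ₗ[ℝ] F →L[ℝ] ℝ) := by
    rw [← LinearMap.ker_eq_bot, LinearMap.ker_eq_bot']
    exact fun v hv => hA v fun w => congrArg (fun L : F →L[ℝ] ℝ => L w) hv
  have hdim : Module.finrank ℝ F = Module.finrank ℝ (F →L[ℝ] ℝ) := by
    rw [← Subspace.dual_finrank_eq (K := ℝ) (V := F)]
    exact (LinearMap.toContinuousLinearMap (𝕜 := ℝ) (E := F) (F' := ℝ)).finrank_eq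
  exact ⟨(LinearEquiv.ofInjectiveOfFinrankEq (A : F →ₗ[ℝ] F →L[ℝ] ℝ) hinj
    hdim).toContinuousLinearEquiv, rfl⟩

theorem isInvertible_of_pos [FiniteDimensional ℝ F] {A : F →L[ℝ] F →L[ℝ] ℝ}
    (hA : ∀ v, v ≠ 0 → 0 < A v v) : A.IsInvertible :=
  isInvertible_of_injective A fun v hv => by
    by_contra hne
    exact (hA v hne).ne' (hv v)

theorem eventually_isInvertible [CompleteSpace F] {T : Type*} [TopologicalSpace T]
    {G : T → F →L[ℝ] F →L[ℝ] ℝ} {p : T} (hG : ContinuousAt G p) (hinv : (G p).IsInvertible) :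
    ∀ᶠ q in 𝓝 p, (G q).IsInvertible := by
  obtain ⟨e, he⟩ := hinv
  have hnhds := ContinuousLinearEquiv.nhds e
  rw [he] at hnhds
  exact hG hnhds

/-- The Christoffel symbols of the first kind, as a linear function of the derivative `D` of the
metric: `(v, w, z) ↦ (D_v g(w, z) + D_w g(v, z) - D_z g(v, w)) / 2`. -/
def firstKind : (F →L[ℝ] F →L[ℝ] F →L[ℝ] ℝ) →L[ℝ] F →L[ℝ] F →L[ℝ] F →L[ℝ] ℝ :=
  let flip₁₂ : (F →L[ℝ] F →L[ℝ] F →L[ℝ] ℝ) →L[ℝ] F →L[ℝ] F →L[ℝ] F →L[ℝ] ℝ :=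
    ContinuousLinearMap.flipₗᵢ ℝ F F (F →L[ℝ] ℝ)
  let flip₂₃ : (F →L[ℝ] F →L[ℝ] F →L[ℝ] ℝ) →L[ℝ] F →L[ℝ] F →L[ℝ] F →L[ℝ] ℝ :=
    ContinuousLinearMap.compL ℝ F (F →L[ℝ] F →L[ℝ] ℝ) (F →L[ℝ] F →L[ℝ] ℝ)
      (ContinuousLinearMap.flipₗᵢ ℝ F F ℝ)
  (1 / 2 : ℝ) • (ContinuousLinearMap.id ℝ _ + flip₁₂ - flip₂₃ ∘L flip₁₂)

theorem firstKind_apply (D : F →L[ℝ] F →L[ℝ] F →L[ℝ] ℝ) (v w z : F) :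
    firstKind D v w z = (1 / 2) * (D v w z + D w v z - D z v w) :=
  rfl

/-- The Christoffel symbols `Γ(v, w)` of a metric with value `A` and derivative `D` at a point. -/
def christoffelMap (A : F →L[ℝ] F →L[ℝ] ℝ) (D : F →L[ℝ] F →L[ℝ] F →L[ℝ] ℝ) : F →L[ℝ] F →L[ℝ] F :=
  ContinuousLinearMap.compL ℝ F (F →L[ℝ] ℝ) F A.inverse ∘L firstKind D

theorem christoffel_eq_christoffelMap (G : F → F →L[ℝ] F →L[ℝ] ℝ) (p v w : F) :
    christoffel G p v w = christoffelMap (G p) (fderiv ℝ G p) v w :=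
  rfl

theorem apply_christoffelMap {A : F →L[ℝ] F →L[ℝ] ℝ} (hA : A.IsInvertible)
    (D : F →L[ℝ] F →L[ℝ] F →L[ℝ] ℝ) (v w z : F) :
    A (christoffelMap A D v w) z = firstKind D v w z := by
  obtain ⟨e, rfl⟩ := hA
  simp [christoffelMap]

theorem christoffelMap_comm (A : F →L[ℝ] F →L[ℝ] ℝ) {D : F →L[ℝ] F →L[ℝ] F →L[ℝ] ℝ}
    (hD : ∀ z v w, D z v w = D z w v) (v w : F) :
    christoffelMap A D v w = christoffelMap A D w v := by
  have hsymm : firstKind D v w = firstKind D w v := by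
    ext z
    rw [firstKind_apply, firstKind_apply, hD z v w]
    ring
  simp [christoffelMap, hsymm]

theorem metric_compatibility {A : F →L[ℝ] F →L[ℝ] ℝ} (hA : A.IsInvertible)
    (hA_symm : ∀ v w, A v w = A w v) {D : F →L[ℝ] F →L[ℝ] F →L[ℝ] ℝ}
    (hD : ∀ z v w, D z v w = D z w v) (a v w : F) :
    D a v w = A (christoffelMap A D a v) w + A v (christoffelMap A D a w) := by
  rw [hA_symm v, apply_christoffelMap hA, apply_christoffelMap hA, firstKind_apply,
    firstKind_apply]
  linarith [hD a v w, hD v a w, hD w a v]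

theorem differentiableAt_christoffelMap [CompleteSpace F] {A : H → F →L[ℝ] F →L[ℝ] ℝ}
    {D : H → F →L[ℝ] F →L[ℝ] F →L[ℝ] ℝ} {p : H} (hA : DifferentiableAt ℝ A p)
    (hD : DifferentiableAt ℝ D p) (hinv : (A p).IsInvertible) :
    DifferentiableAt ℝ (fun q => christoffelMap (A q) (D q)) p := by
  have hinverse : DifferentiableAt ℝ (fun q => (A q).inverse) p := by
    obtain ⟨e, he⟩ := hinv
    have h := (contDiffAt_map_inverse (n := 1) e).differentiableAt (by norm_num)
    rw [he] at h
    exact h.comp p hA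
  exact ((ContinuousLinearMap.compL ℝ F (F →L[ℝ] ℝ) F).differentiableAt.comp p hinverse).clm_comp
    (firstKind.differentiableAt.comp p hD)

theorem apply_fderiv_christoffelMap [CompleteSpace F] {A : H → F →L[ℝ] F →L[ℝ] ℝ}
    {D : H → F →L[ℝ] F →L[ℝ] F →L[ℝ] ℝ} {p : H} (hA : DifferentiableAt ℝ A p)
    (hD : DifferentiableAt ℝ D p) (hinv : (A p).IsInvertible) (a : H) (v w z : F) :
    A p (fderiv ℝ (fun q => christoffelMap (A q) (D q)) p a v w) z
      = firstKind (fderiv ℝ D p a) v w z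
        - fderiv ℝ A p a (christoffelMap (A p) (D p) v w) z := by
  have hΓ := differentiableAt_christoffelMap hA hD hinv
  have hΓvw : DifferentiableAt ℝ (fun q => christoffelMap (A q) (D q) v w) p := by fun_prop
  have hK : DifferentiableAt ℝ (fun q => firstKind (D q)) p := firstKind.differentiableAt.comp p hD
  have heq : (fun q => A q (christoffelMap (A q) (D q) v w) z)
      =ᶠ[𝓝 p] fun q => firstKind (D q) v w z := by
    filter_upwards [eventually_isInvertible hA.continuousAt hinv] with q hq
    exact apply_christoffelMap hq (D q) v w z
  have hderiv := fderiv_bilin hA hΓvw (differentiableAt_const z) a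
  rw [heq.fderiv_eq, fderiv_bilin_apply (hK.clm_apply (differentiableAt_const v)),
    fderiv_apply_const hK, fderiv_bilin_apply hΓ, fderiv_const_apply,
    show fderiv ℝ (fun q => firstKind (D q)) p a = firstKind (fderiv ℝ D p a) from
      congrArg (· a) (firstKind.hasFDerivAt.comp p hD.hasFDerivAt).fderiv] at hderiv
  simp only [zero_apply, map_zero, add_zero] at hderiv
  linarith

end Coordinates

section Curvature

variable {F : Type*} [NormedAddCommGroup F] [NormedSpace ℝ F]
variable {H : Type*} [NormedAddCommGroup H] [NormedSpace ℝ H]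

theorem curvature_antisymm_left (G : F → F →L[ℝ] F →L[ℝ] ℝ) (p v w z : F) :
    curvature G p v w z = - curvature G p w v z := by
  simp only [curvature]
  abel

theorem curvature_self_left (G : F → F →L[ℝ] F →L[ℝ] ℝ) (p v z : F) : curvature G p v v z = 0 := by
  simp [curvature]

/-- `G` is a pseudo-Riemannian metric, twice continuously differentiable at `p`. The domain `H` may
differ from `F`, so that `G` can be a family of metrics on `F` depending on a parameter. -/
structure IsMetricAt (G : H → F →L[ℝ] F →L[ℝ] ℝ) (p : H) : Prop where
  contDiffAt : ContDiffAt ℝ 2 G p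
  symm : ∀ q v w, G q v w = G q w v
  isInvertible : (G p).IsInvertible

namespace IsMetricAt

theorem differentiableAt {G : H → F →L[ℝ] F →L[ℝ] ℝ} {p : H} (hG : IsMetricAt G p) :
    DifferentiableAt ℝ G p :=
  hG.contDiffAt.differentiableAt (by norm_num)

theorem fderiv_symm {G : H → F →L[ℝ] F →L[ℝ] ℝ} {p : H} (hG : IsMetricAt G p) (a : H) (v w : F) :
    fderiv ℝ G p a v w = fderiv ℝ G p a w v :=
  fderiv_bilin_symm hG.differentiableAt hG.symm a v w

variable {G : F → F →L[ℝ] F →L[ℝ] ℝ} {p : F}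

theorem fderiv_eq (hG : IsMetricAt G p) (a v w : F) :
    fderiv ℝ G p a v w = G p (christoffel G p a v) w + G p v (christoffel G p a w) :=
  metric_compatibility hG.isInvertible (hG.symm p) hG.fderiv_symm a v w

theorem lieDeriv_eq_cov {W X Y : F → F} (hG : IsMetricAt G p) (hX : DifferentiableAt ℝ X p)
    (hY : DifferentiableAt ℝ Y p) :
    fderiv ℝ (fun z => G z (X z) (Y z)) p (W p) - G p (VectorField.lieBracket ℝ W X p) (Y p)
        - G p (X p) (VectorField.lieBracket ℝ W Y p)
      = G p (cov G W p (X p)) (Y p) + G p (cov G W p (Y p)) (X p) := by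
  have hcomm (v w : F) : christoffel G p v w = christoffel G p w v :=
    christoffelMap_comm (G p) hG.fderiv_symm v w
  rw [fderiv_bilin hG.differentiableAt hX hY, hG.fderiv_eq, hG.symm p (cov G W p (Y p))]
  simp only [VectorField.lieBracket, cov, map_add, map_sub, add_apply, sub_apply, hcomm (W p)]
  ring

theorem inner_lieBracket_eq_cov {W X Y : F → F} (hG : IsMetricAt G p)
    (hW : DifferentiableAt ℝ W p) (hX : DifferentiableAt ℝ X p) (hY : DifferentiableAt ℝ Y p)
    (hWX : ∀ᶠ q in 𝓝 p, G q (W q) (X q) = 0) (hWY : ∀ᶠ q in 𝓝 p, G q (W q) (Y q) = 0) :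
    G p (W p) (VectorField.lieBracket ℝ X Y p)
      = G p (cov G W p (Y p)) (X p) - G p (cov G W p (X p)) (Y p) := by
  have inner_cov {Z : F → F} (hZ : DifferentiableAt ℝ Z p)
      (hWZ : ∀ᶠ q in 𝓝 p, G q (W q) (Z q) = 0) (v : F) :
      G p (W p) (cov G Z p v) = - G p (cov G W p v) (Z p) := by
    have hderiv := fderiv_bilin hG.differentiableAt hW hZ v
    rw [Filter.EventuallyEq.fderiv_eq (f := fun _ => (0 : ℝ)) hWZ, hG.fderiv_eq] at hderiv
    simp only [fderiv_const_apply, zero_apply] at hderiv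
    simp only [cov, map_add, add_apply]
    linarith
  have htorsion : VectorField.lieBracket ℝ X Y p = cov G Y p (X p) - cov G X p (Y p) := by
    rw [cov, cov, christoffel_eq_christoffelMap, christoffel_eq_christoffelMap,
      christoffelMap_comm (G p) hG.fderiv_symm (X p), add_sub_add_right_eq_sub,
      VectorField.lieBracket]
  rw [htorsion, map_sub, inner_cov hY hWY, inner_cov hX hWX]
  ring

variable [CompleteSpace F]

theorem eventually {G : H → F →L[ℝ] F →L[ℝ] ℝ} {p : H} (hG : IsMetricAt G p) :
    ∀ᶠ q in 𝓝 p, IsMetricAt G q := by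
  filter_upwards [hG.contDiffAt.eventually (by simp),
    eventually_isInvertible hG.contDiffAt.continuousAt hG.isInvertible] with q hq hq_inv
  exact ⟨hq, hG.symm, hq_inv⟩

theorem curvature_eq (hG : IsMetricAt G p) (v w z : F) :
    curvature G p v w z
      = fderiv ℝ (fun q => christoffelMap (G q) (fderiv ℝ G q)) p v w z
        - fderiv ℝ (fun q => christoffelMap (G q) (fderiv ℝ G q)) p w v z
        + christoffelMap (G p) (fderiv ℝ G p) v (christoffelMap (G p) (fderiv ℝ G p) w z)
        - christoffelMap (G p) (fderiv ℝ G p) w (christoffelMap (G p) (fderiv ℝ G p) v z) := by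
  have hΓ := differentiableAt_christoffelMap hG.differentiableAt
    (differentiableAt_fderiv hG.contDiffAt) hG.isInvertible
  rw [← fderiv_bilin_apply hΓ, ← fderiv_bilin_apply hΓ]
  rfl

theorem isLinearMap_curvature (hG : IsMetricAt G p) (w z : F) :
    IsLinearMap ℝ fun v => curvature G p v w z where
  map_add v v' := by
    simp only [hG.curvature_eq, map_add, add_apply]
    abel
  map_smul c v := by
    simp only [hG.curvature_eq, map_smul, smul_apply, smul_add, smul_sub]

theorem apply_curvature (hG : IsMetricAt G p) (v w z q : F) :
    G p (curvature G p v w z) q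
      = (1 / 2) * (fderiv ℝ (fderiv ℝ G) p v z w q - fderiv ℝ (fderiv ℝ G) p v q w z
          - fderiv ℝ (fderiv ℝ G) p w z v q + fderiv ℝ (fderiv ℝ G) p w q v z)
        - G p (christoffel G p w z) (christoffel G p v q)
        + G p (christoffel G p v z) (christoffel G p w q) := by
  have hderiv := apply_fderiv_christoffelMap hG.differentiableAt
    (differentiableAt_fderiv hG.contDiffAt) hG.isInvertible
  simp only [hG.curvature_eq, map_add, map_sub, add_apply, sub_apply]
  rw [hderiv, hderiv, hG.fderiv_eq v, hG.fderiv_eq w]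
  simp only [firstKind_apply, christoffel_eq_christoffelMap, fderiv_fderiv_swap hG.contDiffAt v w]
  ring

theorem curvature_antisymm_right (hG : IsMetricAt G p) (v w z q : F) :
    G p (curvature G p v w z) q = - G p (curvature G p v w q) z := by
  rw [hG.apply_curvature, hG.apply_curvature, hG.symm p (christoffel G p w q),
    hG.symm p (christoffel G p v q)]
  ring

theorem curvature_self_right (hG : IsMetricAt G p) (v w z : F) :
    G p (curvature G p v w z) z = 0 := by
  linarith [hG.curvature_antisymm_right v w z z]

theorem curvature_swap_swap (hG : IsMetricAt G p) (v w z q : F) :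
    G p (curvature G p v w z) q = G p (curvature G p w v q) z := by
  rw [curvature_antisymm_left, map_neg, neg_apply, hG.curvature_antisymm_right, neg_neg]

end IsMetricAt

end Curvature

section Slices

variable {E : Type*} [NormedAddCommGroup E] [NormedSpace ℝ E]
variable {V : Type*} [NormedAddCommGroup V] [NormedSpace ℝ V]

theorem tendsto_slice {X : Type*} [TopologicalSpace X] (p : ℝ × X) :
    Filter.Tendsto (fun z => (p.1, z)) (𝓝 p.2) (𝓝 p) :=
  (Continuous.prodMk_right p.1).continuousAt.tendsto

theorem contDiffAt_slice {n : WithTop ℕ∞} {f : ℝ × E → V} {p : ℝ × E} (hf : ContDiffAt ℝ n f p) :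
    ContDiffAt ℝ n (fun z => f (p.1, z)) p.2 :=
  ContDiffAt.comp p.2 (show ContDiffAt ℝ n f (p.1, p.2) from hf)
    (contDiffAt_const.prodMk contDiffAt_id)

theorem fderiv_slice {f : ℝ × E → V} {p : ℝ × E} (hf : DifferentiableAt ℝ f p) :
    fderiv ℝ (fun z => f (p.1, z)) p.2 = fderiv ℝ f p ∘L ContinuousLinearMap.inr ℝ ℝ E :=
  ((show HasFDerivAt f (fderiv ℝ f p) (p.1, p.2) from hf.hasFDerivAt).comp p.2
    (hasFDerivAt_prodMk_right p.1 p.2)).fderiv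

theorem fderiv_slice_apply {f : ℝ × E → V} {p : ℝ × E} (hf : DifferentiableAt ℝ f p) (v : E) :
    fderiv ℝ (fun z => f (p.1, z)) p.2 v = fderiv ℝ f p (0, v) := by
  rw [fderiv_slice hf]
  rfl

theorem deriv_slice {f : ℝ × E → V} {p : ℝ × E} (hf : DifferentiableAt ℝ f p) :
    deriv (fun s => f (s, p.2)) p.1 = fderiv ℝ f p (1, 0) :=
  ((show HasFDerivAt f (fderiv ℝ f p) (p.1, p.2) from hf.hasFDerivAt).comp p.1
    (hasFDerivAt_prodMk_left (𝕜 := ℝ) p.1 p.2)).hasDerivAt.deriv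

theorem one_prod_eq_add {A : Type*} [AddMonoid A] (v : A) : ((1 : ℝ), v) = (1, 0) + (0, v) := by
  simp

/-- The Christoffel symbols of the metric on the slice of constant time through `p`. -/
def sliceChristoffel (g : ℝ × E → E →L[ℝ] E →L[ℝ] ℝ) (p : ℝ × E) : E →L[ℝ] E →L[ℝ] E :=
  christoffelMap (g p) (fderiv ℝ g p ∘L ContinuousLinearMap.inr ℝ ℝ E)

/-- The covariant derivative `v ↦ ∇_v u` of `u` within the slice of constant time through `p`. -/
def sliceCov (g : ℝ × E → E →L[ℝ] E →L[ℝ] ℝ) (u : ℝ × E → E) (p : ℝ × E) : E →L[ℝ] E :=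
  fderiv ℝ u p ∘L ContinuousLinearMap.inr ℝ ℝ E + (sliceChristoffel g p).flip (u p)

/-- The tensor `g(∇_v u, w)` on the slices of constant time. -/
def shape (g : ℝ × E → E →L[ℝ] E →L[ℝ] ℝ) (u : ℝ × E → E) (p : ℝ × E) : E →L[ℝ] E →L[ℝ] ℝ :=
  g p ∘L sliceCov g u p

/-- The covariant derivative `(∇_v ġ)(w, z)` of the time derivative `ġ` of the metrics, within the
slice of constant time through `p`. -/
def covTimeDeriv (g : ℝ × E → E →L[ℝ] E →L[ℝ] ℝ) (p : ℝ × E) (v w z : E) : ℝ :=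
  fderiv ℝ (fderiv ℝ g) p (0, v) (1, 0) w z - fderiv ℝ g p (1, 0) (sliceChristoffel g p v w) z
    - fderiv ℝ g p (1, 0) w (sliceChristoffel g p v z)

/-- The derivative of the vector field `X` along `∂_t + u`, covariant in the spatial directions. -/
def flowDeriv (g : ℝ × E → E →L[ℝ] E →L[ℝ] ℝ) (u X : ℝ × E → E) (p : ℝ × E) : E :=
  fderiv ℝ X p (1, u p) + sliceChristoffel g p (u p) (X p)

variable {g : ℝ × E → E →L[ℝ] E →L[ℝ] ℝ} {u X Y : ℝ × E → E} {p : ℝ × E}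

theorem sliceCov_apply (v : E) :
    sliceCov g u p v = fderiv ℝ u p (0, v) + sliceChristoffel g p v (u p) :=
  rfl

theorem shape_apply (v w : E) : shape g u p v w = g p (sliceCov g u p v) w :=
  rfl

theorem christoffel_slice (hg : DifferentiableAt ℝ g p) (v w : E) :
    christoffel (fun z => g (p.1, z)) p.2 v w = sliceChristoffel g p v w := by
  rw [christoffel_eq_christoffelMap, fderiv_slice hg]
  rfl

theorem cov_slice (hg : DifferentiableAt ℝ g p) (hu : DifferentiableAt ℝ u p) (v : E) :
    cov (fun z => g (p.1, z)) (fun z => u (p.1, z)) p.2 v = sliceCov g u p v := by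
  rw [cov, fderiv_slice_apply hu, christoffel_slice hg]
  rfl

namespace IsMetricAt

theorem slice (hg : IsMetricAt g p) : IsMetricAt (fun z => g (p.1, z)) p.2 where
  contDiffAt := contDiffAt_slice hg.contDiffAt
  symm z := hg.symm (p.1, z)
  isInvertible := hg.isInvertible

theorem sliceChristoffel_comm (hg : IsMetricAt g p) (v w : E) :
    sliceChristoffel g p v w = sliceChristoffel g p w v :=
  christoffelMap_comm (g p) (fun _ => hg.fderiv_symm _) v w

theorem fderiv_sliceChristoffel_eq (hg : IsMetricAt g p) (v w z : E) :
    fderiv ℝ g p (0, v) w z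
      = g p (sliceChristoffel g p v w) z + g p w (sliceChristoffel g p v z) :=
  metric_compatibility (D := fderiv ℝ g p ∘L ContinuousLinearMap.inr ℝ ℝ E) hg.isInvertible
    (hg.symm p) (fun _ => hg.fderiv_symm _) v w z

theorem covTimeDeriv_symm (hg : IsMetricAt g p) (v w z : E) :
    covTimeDeriv g p v w z = covTimeDeriv g p v z w := by
  rw [covTimeDeriv, covTimeDeriv, fderiv_fderiv_bilin_symm hg.contDiffAt hg.symm,
    hg.fderiv_symm (1, 0) w, hg.fderiv_symm (1, 0) z]
  ring

theorem fderiv_metric_flowDeriv (hg : IsMetricAt g p) (hX : DifferentiableAt ℝ X p)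
    (hY : DifferentiableAt ℝ Y p) :
    fderiv ℝ (fun q => g q (X q) (Y q)) p (1, u p)
      = fderiv ℝ g p (1, 0) (X p) (Y p) + g p (flowDeriv g u X p) (Y p)
        + g p (X p) (flowDeriv g u Y p) := by
  rw [fderiv_bilin hg.differentiableAt hX hY, one_prod_eq_add, map_add, add_apply, add_apply,
    hg.fderiv_sliceChristoffel_eq, ← one_prod_eq_add]
  simp only [flowDeriv, map_add, add_apply]
  ring

variable [CompleteSpace E]

theorem differentiableAt_sliceChristoffel (hg : IsMetricAt g p) :
    DifferentiableAt ℝ (sliceChristoffel g) p :=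
  differentiableAt_christoffelMap hg.differentiableAt
    ((differentiableAt_fderiv hg.contDiffAt).clm_comp (differentiableAt_const _)) hg.isInvertible

theorem apply_timeDeriv_sliceChristoffel (hg : IsMetricAt g p) (v w z : E) :
    g p (fderiv ℝ (sliceChristoffel g) p (1, 0) v w) z
      = (1 / 2) * (covTimeDeriv g p v w z + covTimeDeriv g p w v z - covTimeDeriv g p z v w) := by
  have hD := differentiableAt_fderiv hg.contDiffAt
  have hderiv := apply_fderiv_christoffelMap hg.differentiableAt
    (hD.clm_comp (differentiableAt_const (ContinuousLinearMap.inr ℝ ℝ E))) hg.isInvertible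
    (1, 0) v w z
  have hD_inr (x : E) : fderiv ℝ (fun q => fderiv ℝ g q ∘L ContinuousLinearMap.inr ℝ ℝ E) p (1, 0) x
      = fderiv ℝ (fderiv ℝ g) p (0, x) (1, 0) := by
    rw [fderiv_clm_comp hD (differentiableAt_const _), fderiv_fderiv_swap hg.contDiffAt (0, x)]
    simp
  have hġ := hg.fderiv_symm (1, 0)
  rw [firstKind_apply, hD_inr, hD_inr, hD_inr] at hderiv
  rw [covTimeDeriv, covTimeDeriv, covTimeDeriv, hg.sliceChristoffel_comm w v,
    hg.sliceChristoffel_comm z v, hg.sliceChristoffel_comm z w,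
    hġ (sliceChristoffel g p v z) w]
  refine hderiv.trans ?_
  change _ - fderiv ℝ g p (1, 0) (sliceChristoffel g p v w) z = _
  ring

theorem curvature_slice (hg : IsMetricAt g p) (v w z : E) :
    curvature (fun z => g (p.1, z)) p.2 v w z
      = fderiv ℝ (sliceChristoffel g) p (0, v) w z - fderiv ℝ (sliceChristoffel g) p (0, w) v z
        + sliceChristoffel g p v (sliceChristoffel g p w z)
        - sliceChristoffel g p w (sliceChristoffel g p v z) := by
  have hΓ_slice : (fun x => christoffelMap (g (p.1, x)) (fderiv ℝ (fun z => g (p.1, z)) x))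
      =ᶠ[𝓝 p.2] fun x => sliceChristoffel g (p.1, x) := by
    filter_upwards [(tendsto_slice p).eventually hg.eventually] with x hx
    rw [fderiv_slice (p := (p.1, x)) hx.differentiableAt]
    rfl
  rw [hg.slice.curvature_eq, hΓ_slice.fderiv_eq, hΓ_slice.eq_of_nhds,
    fderiv_slice_apply hg.differentiableAt_sliceChristoffel,
    fderiv_slice_apply hg.differentiableAt_sliceChristoffel]

theorem differentiableAt_sliceCov (hg : IsMetricAt g p) (hu : ContDiffAt ℝ 2 u p) :
    DifferentiableAt ℝ (sliceCov g u) p :=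
  ((differentiableAt_fderiv hu).clm_comp (differentiableAt_const _)).add
    (((ContinuousLinearMap.flipₗᵢ ℝ E E E).differentiableAt.comp p
      hg.differentiableAt_sliceChristoffel).clm_apply (hu.differentiableAt (by norm_num)))

theorem differentiableAt_shape (hg : IsMetricAt g p) (hu : ContDiffAt ℝ 2 u p) :
    DifferentiableAt ℝ (shape g u) p :=
  hg.differentiableAt.clm_comp (hg.differentiableAt_sliceCov hu)

theorem fderiv_sliceCov (hg : IsMetricAt g p) (hu : ContDiffAt ℝ 2 u p) (a : ℝ × E) (v : E) :
    fderiv ℝ (sliceCov g u) p a v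
      = fderiv ℝ (fderiv ℝ u) p a (0, v) + fderiv ℝ (sliceChristoffel g) p a v (u p)
        + sliceChristoffel g p v (fderiv ℝ u p a) := by
  have hDu := differentiableAt_fderiv hu
  have hΓ := hg.differentiableAt_sliceChristoffel.clm_apply (differentiableAt_const v)
  have hu' := hu.differentiableAt (n := 2) (by norm_num)
  rw [← fderiv_apply_const (hg.differentiableAt_sliceCov hu)]
  simp only [sliceCov_apply]
  rw [fderiv_fun_add (hDu.clm_apply (differentiableAt_const _)) (hΓ.clm_apply hu'), add_apply,
    fderiv_apply_const hDu, fderiv_clm_apply hΓ hu', add_apply,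
    ContinuousLinearMap.flip_apply, fderiv_apply_const hg.differentiableAt_sliceChristoffel]
  simp only [ContinuousLinearMap.comp_apply]
  abel

theorem ricci_identity (hg : IsMetricAt g p) (hu : ContDiffAt ℝ 2 u p) (v w : E) :
    fderiv ℝ (sliceCov g u) p (0, v) w + sliceChristoffel g p v (sliceCov g u p w)
        - (fderiv ℝ (sliceCov g u) p (0, w) v + sliceChristoffel g p w (sliceCov g u p v))
      = curvature (fun z => g (p.1, z)) p.2 v w (u p) := by
  rw [hg.fderiv_sliceCov hu, hg.fderiv_sliceCov hu, hg.curvature_slice, sliceCov_apply,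
    sliceCov_apply, fderiv_fderiv_swap hu (0, v), map_add, map_add]
  abel

end IsMetricAt

end Slices

section Flow

variable {E : Type*} [NormedAddCommGroup E] [NormedSpace ℝ E]

/-- At the point `p` and, within the slice of constant time, near `p`, the field `u` is a unit
field with `∂u/∂t = - ∇_u u`, and the time derivative of `g` is horizontal. -/
structure IsFlowAt (g : ℝ × E → E →L[ℝ] E →L[ℝ] ℝ) (u : ℝ × E → E) (p : ℝ × E) : Prop
    extends IsMetricAt g p where
  contDiffAt_field : ContDiffAt ℝ 2 u p
  unit : ∀ᶠ z in 𝓝 p.2, g (p.1, z) (u (p.1, z)) (u (p.1, z)) = 1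
  timeDeriv_field : ∀ᶠ z in 𝓝 p.2,
    fderiv ℝ u (p.1, z) (1, 0) = - sliceCov g u (p.1, z) (u (p.1, z))
  timeDeriv_metric : ∀ᶠ z in 𝓝 p.2, ∀ w, fderiv ℝ g (p.1, z) (1, 0) (u (p.1, z)) w = 0

namespace IsFlowAt

variable {g : ℝ × E → E →L[ℝ] E →L[ℝ] ℝ} {u X Y : ℝ × E → E} {p : ℝ × E}

theorem differentiableAt_field (hf : IsFlowAt g u p) : DifferentiableAt ℝ u p :=
  hf.contDiffAt_field.differentiableAt (by norm_num)

theorem timeDeriv_field_eq (hf : IsFlowAt g u p) :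
    fderiv ℝ u p (1, 0) = - sliceCov g u p (u p) :=
  hf.timeDeriv_field.self_of_nhds

theorem timeDeriv_metric_eq (hf : IsFlowAt g u p) (w : E) : fderiv ℝ g p (1, 0) (u p) w = 0 :=
  hf.timeDeriv_metric.self_of_nhds w

theorem flowDeriv_field (hf : IsFlowAt g u p) : flowDeriv g u u p = 0 := by
  rw [flowDeriv, one_prod_eq_add, map_add, hf.timeDeriv_field_eq, sliceCov_apply]
  abel

theorem shape_field_right (hf : IsFlowAt g u p) (v : E) : shape g u p v (u p) = 0 := by
  have hu := hf.differentiableAt_field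
  have hderiv := fderiv_bilin hf.differentiableAt hu hu (0, v)
  have hunit : (fun z => g (p.1, z) (u (p.1, z)) (u (p.1, z))) =ᶠ[𝓝 p.2] fun _ => 1 := hf.unit
  rw [← fderiv_slice_apply (hf.differentiableAt.clm_apply hu |>.clm_apply hu), hunit.fderiv_eq,
    hf.fderiv_sliceChristoffel_eq, hf.symm p (u p), hf.symm p (u p)] at hderiv
  simp only [fderiv_const_apply, zero_apply] at hderiv
  rw [shape_apply, sliceCov_apply, map_add, add_apply]
  linarith

theorem covTimeDeriv_field (hf : IsFlowAt g u p) (v w : E) :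
    covTimeDeriv g p v (u p) w = - fderiv ℝ g p (1, 0) (sliceCov g u p v) w := by
  have hD := (differentiableAt_fderiv hf.contDiffAt).clm_apply (differentiableAt_const (1, 0))
  have hu := hf.differentiableAt_field
  have hderiv := fderiv_bilin hD hu (differentiableAt_const w) (0, v)
  have hzero : (fun z => fderiv ℝ g (p.1, z) (1, 0) (u (p.1, z)) w) =ᶠ[𝓝 p.2] fun _ => 0 :=
    hf.timeDeriv_metric.mono fun z hz => hz w
  rw [← fderiv_slice_apply (hD.clm_apply hu |>.clm_apply (differentiableAt_const w)),
    hzero.fderiv_eq, fderiv_apply_const (differentiableAt_fderiv hf.contDiffAt)] at hderiv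
  simp only [fderiv_const_apply, zero_apply, map_zero, add_zero] at hderiv
  rw [covTimeDeriv, hf.timeDeriv_metric_eq, sliceCov_apply, map_add, add_apply]
  linarith

variable [CompleteSpace E]

theorem fderiv_timeDeriv_field (hf : IsFlowAt g u p) (v : E) :
    fderiv ℝ (fderiv ℝ u) p (0, v) (1, 0)
      = - (fderiv ℝ (sliceCov g u) p (0, v) (u p) + sliceCov g u p (fderiv ℝ u p (0, v))) := by
  have hDu := differentiableAt_fderiv hf.contDiffAt_field
  have hS := hf.differentiableAt_sliceCov hf.contDiffAt_field
  have hu := hf.differentiableAt_field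
  have heq : (fun z => fderiv ℝ u (p.1, z) (1, 0))
      =ᶠ[𝓝 p.2] fun z => - sliceCov g u (p.1, z) (u (p.1, z)) := hf.timeDeriv_field
  rw [← fderiv_apply_const hDu,
    ← fderiv_slice_apply (hDu.clm_apply (differentiableAt_const (1, 0))), heq.fderiv_eq,
    fderiv_slice_apply (hS.clm_apply hu).fun_neg, fderiv_fun_neg, fderiv_clm_apply hS hu]
  simp only [neg_apply, add_apply, ContinuousLinearMap.comp_apply, ContinuousLinearMap.flip_apply]
  abel

theorem flowDeriv_sliceCov (hf : IsFlowAt g u p) (hX : DifferentiableAt ℝ X p) :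
    flowDeriv g u (fun q => sliceCov g u q (X q)) p
      = fderiv ℝ (sliceChristoffel g) p (1, 0) (X p) (u p) - sliceCov g u p (sliceCov g u p (X p))
        - curvature (fun z => g (p.1, z)) p.2 (X p) (u p) (u p)
        + sliceCov g u p (flowDeriv g u X p) := by
  have hS := hf.differentiableAt_sliceCov hf.contDiffAt_field
  have htime : fderiv ℝ (sliceCov g u) p (1, 0) (X p)
      = - (fderiv ℝ (sliceCov g u) p (0, X p) (u p)
          + sliceCov g u p (sliceCov g u p (X p) - sliceChristoffel g p (X p) (u p)))
        + fderiv ℝ (sliceChristoffel g) p (1, 0) (X p) (u p)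
        - sliceChristoffel g p (X p) (sliceCov g u p (u p)) := by
    rw [hf.fderiv_sliceCov hf.contDiffAt_field, hf.timeDeriv_field_eq,
      fderiv_fderiv_swap hf.contDiffAt_field, hf.fderiv_timeDeriv_field, sliceCov_apply (X p)]
    simp only [add_sub_cancel_right, map_neg]
    abel
  have hspace := hf.ricci_identity hf.contDiffAt_field (X p) (u p)
  have hsplit : fderiv ℝ (sliceCov g u) p (1, u p) (X p)
      = fderiv ℝ (sliceCov g u) p (1, 0) (X p) + fderiv ℝ (sliceCov g u) p (0, u p) (X p) := by
    rw [one_prod_eq_add, map_add, add_apply]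
  rw [flowDeriv, fderiv_clm_apply hS hX, add_apply, ContinuousLinearMap.comp_apply,
    ContinuousLinearMap.flip_apply, hsplit, htime, ← hspace, flowDeriv,
    hf.sliceChristoffel_comm (u p) (X p), map_add, map_sub]
  abel

theorem fderiv_shape (hf : IsFlowAt g u p) (hX : DifferentiableAt ℝ X p)
    (hY : DifferentiableAt ℝ Y p) :
    fderiv ℝ (fun q => shape g u q (X q) (Y q)) p (1, u p)
      = - shape g u p (sliceCov g u p (X p)) (Y p)
        - g p (curvature (fun z => g (p.1, z)) p.2 (X p) (u p) (u p)) (Y p)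
        + (1 / 2) * (covTimeDeriv g p (u p) (X p) (Y p)
          + fderiv ℝ g p (1, 0) (sliceCov g u p (X p)) (Y p)
          + fderiv ℝ g p (1, 0) (X p) (sliceCov g u p (Y p)))
        + shape g u p (flowDeriv g u X p) (Y p) + shape g u p (X p) (flowDeriv g u Y p) := by
  have hS := hf.differentiableAt_sliceCov hf.contDiffAt_field
  simp only [shape_apply]
  rw [hf.fderiv_metric_flowDeriv (hS.clm_apply hX) hY, hf.flowDeriv_sliceCov hX]
  simp only [map_add, map_sub, add_apply, sub_apply, hf.apply_timeDeriv_sliceChristoffel]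
  rw [hf.covTimeDeriv_symm _ (X p) (u p), hf.covTimeDeriv_field, hf.covTimeDeriv_field,
    hf.fderiv_symm (1, 0) _ (X p)]
  ring

end IsFlowAt

end Flow

section Spacetime

variable {g : ℝ × E3 → E3 →L[ℝ] E3 →L[ℝ] ℝ} {u : ℝ × E3 → E3} {p : ℝ × E3}

theorem spacetime_apply (g : ℝ × E3 → E3 →L[ℝ] E3 →L[ℝ] ℝ) (p a b : ℝ × E3) :
    spacetime g p a b = g p a.2 b.2 - a.1 * b.1 := by
  simp [spacetime]

theorem contDiffAt_bilinearComp {E F H : Type*} [NormedAddCommGroup E] [NormedSpace ℝ E]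
    [NormedAddCommGroup F] [NormedSpace ℝ F] [NormedAddCommGroup H] [NormedSpace ℝ H]
    {n : WithTop ℕ∞} {G : H → F →L[ℝ] F →L[ℝ] ℝ} {A : H → E →L[ℝ] F} {q : H}
    (hG : ContDiffAt ℝ n G q) (hA : ContDiffAt ℝ n A q) :
    ContDiffAt ℝ n (fun r => (G r).bilinearComp (A r) (A r)) q :=
  (ContinuousLinearMap.flipₗᵢ ℝ E E ℝ).contDiff.contDiffAt.comp q
    (((ContinuousLinearMap.flipₗᵢ ℝ E F ℝ).contDiff.contDiffAt.comp q (hG.clm_comp hA)).clm_comp hA)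

theorem contDiffAt_spacetime {n : WithTop ℕ∞} (hg : ContDiffAt ℝ n g p) :
    ContDiffAt ℝ n (spacetime g) p :=
  (contDiffAt_bilinearComp hg contDiffAt_const).sub contDiffAt_const

theorem fderiv_spacetime_apply (hg : ContDiffAt ℝ 1 g p) (a v w : ℝ × E3) :
    fderiv ℝ (spacetime g) p a v w = fderiv ℝ g p a v.2 w.2 := by
  rw [← fderiv_bilin_apply ((contDiffAt_spacetime hg).differentiableAt (by norm_num)),
    ← fderiv_bilin_apply (hg.differentiableAt (by norm_num))]
  simp only [spacetime_apply]
  rw [fderiv_sub_const]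

theorem fderiv_fderiv_spacetime_apply (hg : ContDiffAt ℝ 2 g p) (a b v w : ℝ × E3) :
    fderiv ℝ (fderiv ℝ (spacetime g)) p a b v w = fderiv ℝ (fderiv ℝ g) p a b v.2 w.2 := by
  have heq : (fun q => fderiv ℝ (spacetime g) q b v w) =ᶠ[𝓝 p] fun q => fderiv ℝ g q b v.2 w.2 := by
    filter_upwards [hg.eventually (by simp)] with q hq
    exact fderiv_spacetime_apply (hq.of_le (by norm_num)) b v w
  rw [← fderiv_fderiv_bilin_apply (contDiffAt_spacetime hg), ← fderiv_fderiv_bilin_apply hg,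
    heq.fderiv_eq]

theorem isInvertible_spacetime (hg : (g p).IsInvertible) : (spacetime g p).IsInvertible := by
  refine isInvertible_of_injective _ fun v hv => Prod.ext ?_ ?_
  · simpa [spacetime_apply] using hv (1, 0)
  · exact injective_of_isInvertible hg fun z => by simpa [spacetime_apply] using hv (0, z)

theorem isMetricAt_spacetime (hg : IsMetricAt g p) : IsMetricAt (spacetime g) p where
  contDiffAt := contDiffAt_spacetime hg.contDiffAt
  symm q v w := by rw [spacetime_apply, spacetime_apply, hg.symm q v.2, mul_comm]
  isInvertible := isInvertible_spacetime hg.isInvertible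

namespace IsMetricAt

theorem apply_christoffel_spacetime (hg : IsMetricAt g p) (v w z : ℝ × E3) :
    spacetime g p (christoffel (spacetime g) p v w) z
      = (1 / 2) * (fderiv ℝ g p v w.2 z.2 + fderiv ℝ g p w v.2 z.2 - fderiv ℝ g p z v.2 w.2) := by
  rw [apply_christoffel _ _ _ _ _ (isInvertible_spacetime hg.isInvertible)]
  simp only [fderiv_spacetime_apply (hg.contDiffAt.of_le (by norm_num))]

theorem christoffel_spacetime_slice (hg : IsMetricAt g p) (v w : E3) :
    (christoffel (spacetime g) p (0, v) (0, w)).2 = sliceChristoffel g p v w := by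
  refine injective_of_isInvertible hg.isInvertible fun z => ?_
  have hΓ := hg.apply_christoffel_spacetime (0, v) (0, w) (0, z)
  simp only [spacetime_apply, mul_zero, sub_zero, hg.fderiv_sliceChristoffel_eq] at hΓ
  rw [hg.sliceChristoffel_comm w v, hg.sliceChristoffel_comm z v, hg.sliceChristoffel_comm z w,
    hg.symm p v (sliceChristoffel g p w z), hg.symm p w (sliceChristoffel g p v z)] at hΓ
  linarith

theorem christoffel_spacetime_time_fst (hg : IsMetricAt g p) (v : E3) :
    (christoffel (spacetime g) p (1, 0) (0, v)).1 = 0 := by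
  simpa [spacetime_apply] using hg.apply_christoffel_spacetime (1, 0) (0, v) (1, 0)

theorem apply_christoffel_spacetime_time_snd (hg : IsMetricAt g p) (v w : E3) :
    g p (christoffel (spacetime g) p (1, 0) (0, v)).2 w
      = (1 / 2) * fderiv ℝ g p (1, 0) v w := by
  simpa [spacetime_apply] using hg.apply_christoffel_spacetime (1, 0) (0, v) (0, w)

/-- The second fundamental form of the slices is half of `ġ`, so this is the Codazzi equation. -/
theorem mixedCurvature_eq (hg : IsMetricAt g p) (v w : E3) :
    mixedCurvature g u p v w
      = (1 / 2) * (covTimeDeriv g p (u p) v w - covTimeDeriv g p w v (u p)) := by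
  have hġ := hg.fderiv_symm (1, 0)
  rw [mixedCurvature, (isMetricAt_spacetime hg).apply_curvature]
  simp only [fderiv_fderiv_spacetime_apply hg.contDiffAt]
  rw [spacetime_apply, spacetime_apply, hg.christoffel_spacetime_time_fst,
    hg.christoffel_spacetime_time_fst, hg.apply_christoffel_spacetime_time_snd,
    hg.christoffel_spacetime_slice, hg.christoffel_spacetime_slice, hg.symm p _ (Prod.snd _),
    hg.apply_christoffel_spacetime_time_snd, fderiv_fderiv_swap hg.contDiffAt (1, 0) (0, u p),
    fderiv_fderiv_swap hg.contDiffAt (1, 0) (0, w), covTimeDeriv, covTimeDeriv,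
    hg.sliceChristoffel_comm (u p) v, hg.sliceChristoffel_comm (u p) w,
    hg.sliceChristoffel_comm w v, hġ w, hġ (u p)]
  simp only [map_zero, zero_apply]
  ring

end IsMetricAt

namespace IsFlowAt

theorem curvR_eq (hf : IsFlowAt g u p) (v w : E3) :
    curvR g u p v w
      = - ricci (fun z => g (p.1, z)) p.2 v w
        + (1 / 4) * (covTimeDeriv g p (u p) v w + fderiv ℝ g p (1, 0) (sliceCov g u p v) w)
        + (1 / 4) * (covTimeDeriv g p (u p) v w + fderiv ℝ g p (1, 0) (sliceCov g u p w) v) := by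
  have mixedCurvature_eq (v w : E3) : mixedCurvature g u p v w
      = (1 / 2) * (covTimeDeriv g p (u p) v w + fderiv ℝ g p (1, 0) (sliceCov g u p w) v) := by
    rw [hf.mixedCurvature_eq, hf.covTimeDeriv_symm w, hf.covTimeDeriv_field, sub_neg_eq_add]
  rw [curvR, mixedCurvature_eq, mixedCurvature_eq, hf.covTimeDeriv_symm (u p) w]
  ring

theorem geodesic_eq (hf : IsFlowAt g u p) :
    (0, fderiv ℝ u p (1, u p)) + christoffel (spacetime g) p (1, u p) (1, u p) = 0 := by
  refine injective_of_isInvertible (isInvertible_spacetime hf.isInvertible)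
    fun z => ?_
  have hz : z = z.1 • (1, 0) + (0, z.2) := by ext <;> simp
  have hflow_dir : fderiv ℝ g p (1, u p) (u p) z.2 = fderiv ℝ g p (0, u p) (u p) z.2 := by
    rw [one_prod_eq_add, map_add, add_apply, add_apply, hf.timeDeriv_metric_eq, zero_add]
  have hz_dir : fderiv ℝ g p z (u p) (u p) = fderiv ℝ g p (0, z.2) (u p) (u p) := by
    conv_lhs => rw [hz]
    rw [map_add, add_apply, add_apply, map_smul, smul_apply, smul_apply, hf.timeDeriv_metric_eq,
      smul_zero, zero_add]
  have hfield : fderiv ℝ u p (1, u p) = - sliceChristoffel g p (u p) (u p) :=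
    eq_neg_of_add_eq_zero_left hf.flowDeriv_field
  rw [map_add, add_apply, hf.apply_christoffel_spacetime, spacetime_apply, hflow_dir, hz_dir,
    hfield, map_neg, neg_apply, hf.fderiv_sliceChristoffel_eq, hf.fderiv_sliceChristoffel_eq,
    hf.sliceChristoffel_comm z.2, hf.symm p (sliceChristoffel g p (u p) z.2), map_zero, zero_apply]
  ring

end IsFlowAt

end Spacetime

section GramSchmidt

variable {E F : Type*} [NormedAddCommGroup E] [NormedSpace ℝ E]
  [NormedAddCommGroup F] [NormedSpace ℝ F] {b : E →L[ℝ] E →L[ℝ] ℝ} {e v : E}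

/-- The component of `v` that is `b`-orthogonal to `e`, provided that `b e e ≠ 0`. -/
def reject (b : E →L[ℝ] E →L[ℝ] ℝ) (e v : E) : E :=
  v - (b e v / b e e) • e

/-- The multiple of `v` of `b`-length one, provided that `b v v` is positive. -/
def unitize (b : E →L[ℝ] E →L[ℝ] ℝ) (v : E) : E :=
  (√(b v v))⁻¹ • v

theorem apply_reject_self (he : b e e ≠ 0) : b e (reject b e v) = 0 := by
  simp [reject, he]

theorem apply_reject_of_apply_eq_zero {f : E} (hf : b f e = 0) : b f (reject b e v) = b f v := by
  simp [reject, hf]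

theorem reject_eq_self (h : b e v = 0) : reject b e v = v := by
  simp [reject, h]

theorem reject_mem_iff {S : Submodule ℝ E} (he : e ∈ S) : reject b e v ∈ S ↔ v ∈ S :=
  S.sub_mem_iff_left (S.smul_mem _ he)

theorem apply_unitize_self (hv : 0 < b v v) : b (unitize b v) (unitize b v) = 1 := by
  simp only [unitize, map_smul, smul_apply, smul_eq_mul]
  rw [← mul_assoc, ← mul_inv, Real.mul_self_sqrt hv.le, inv_mul_cancel₀ hv.ne']

theorem unitize_eq_self (h : b v v = 1) : unitize b v = v := by
  simp [unitize, h]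

variable {n : WithTop ℕ∞} {g : F → E →L[ℝ] E →L[ℝ] ℝ} {X Y : F → E} {p : F}

theorem contDiffAt_reject (hg : ContDiffAt ℝ n g p) (hX : ContDiffAt ℝ n X p)
    (hY : ContDiffAt ℝ n Y p) (h : g p (X p) (X p) ≠ 0) :
    ContDiffAt ℝ n (fun q => reject (g q) (X q) (Y q)) p :=
  hY.sub ((((hg.clm_apply hX).clm_apply hY).div ((hg.clm_apply hX).clm_apply hX) h).smul hX)

theorem contDiffAt_unitize (hg : ContDiffAt ℝ n g p) (hX : ContDiffAt ℝ n X p)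
    (h : 0 < g p (X p) (X p)) : ContDiffAt ℝ n (fun q => unitize (g q) (X q)) p :=
  ((((hg.clm_apply hX).clm_apply hX).sqrt h.ne').inv (Real.sqrt_pos.2 h).ne').smul hX

end GramSchmidt

section Frames

variable {b : E3 →L[ℝ] E3 →L[ℝ] ℝ} {u v w : E3} {e : Fin 2 → E3}

theorem isComplementaryFrame_gramSchmidt {X Y : E3} (hu : b u u ≠ 0)
    (hX : X = unitize b (reject b u v)) (hY : Y = unitize b (reject b X (reject b u w)))
    (hXpos : 0 < b (reject b u v) (reject b u v))
    (hYpos : 0 < b (reject b X (reject b u w)) (reject b X (reject b u w))) :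
    IsComplementaryFrame b u X Y := by
  have hnorm_X : b X X = 1 := hX ▸ apply_unitize_self hXpos
  have horth_uX : b u X = 0 := by
    rw [hX, unitize, map_smul, apply_reject_self hu, smul_zero]
  refine ⟨hnorm_X, hY ▸ apply_unitize_self hYpos, ?_, horth_uX, ?_⟩
  · rw [hY, unitize, map_smul, apply_reject_self (by rw [hnorm_X]; exact one_ne_zero), smul_zero]
  · rw [hY, unitize, map_smul, apply_reject_of_apply_eq_zero horth_uX, apply_reject_self hu,
      smul_zero]

theorem exists_isComplementaryFrame (hpos : ∀ v, v ≠ 0 → 0 < b v v)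
    (hu : b u u ≠ 0) : ∃ X Y, IsComplementaryFrame b u X Y := by
  have exists_notMem (S : Finset E3) (hS : S.card < 3) :
      ∃ v, v ∉ Submodule.span ℝ (S : Set E3) := by
    have hlt := span_lt_top_of_card_lt_finrank (R := ℝ) (s := (S : Set E3)) (by simpa using hS)
    exact (SetLike.exists_of_lt hlt).imp fun v hv => hv.2
  obtain ⟨v, hv⟩ := exists_notMem {u} (by simp)
  let X := unitize b (reject b u v)
  obtain ⟨w, hw⟩ := exists_notMem {u, X} (Finset.card_le_two.trans_lt (by norm_num))
  rw [← reject_mem_iff (b := b) (e := u) (Submodule.subset_span (by simp))] at hv hw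
  rw [← reject_mem_iff (b := b) (e := X) (Submodule.subset_span (by simp))] at hw
  exact ⟨X, _, isComplementaryFrame_gramSchmidt hu rfl rfl
    (hpos _ (ne_of_mem_of_not_mem (zero_mem _) hv).symm)
    (hpos _ (ne_of_mem_of_not_mem (zero_mem _) hw).symm)⟩

theorem exists_contDiffAt_frame {F : Type*} [NormedAddCommGroup F] [NormedSpace ℝ F]
    {n : WithTop ℕ∞} {g : F → E3 →L[ℝ] E3 →L[ℝ] ℝ} {u : F → E3} {p : F}
    (hg : ContDiffAt ℝ n g p) (hu : ContDiffAt ℝ n u p)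
    (hu0 : g p (u p) (u p) ≠ 0) (h : IsComplementaryFrame (g p) (u p) (e 0) (e 1)) :
    ∃ X : Fin 2 → F → E3, (∀ i, ContDiffAt ℝ n (X i) p) ∧ (∀ i, X i p = e i) ∧
      ∀ᶠ q in 𝓝 p, IsComplementaryFrame (g q) (u q) (X 0 q) (X 1 q) := by
  let X₀ : F → E3 := fun q => reject (g q) (u q) (e 0)
  let X : F → E3 := fun q => unitize (g q) (X₀ q)
  let Y₀ : F → E3 := fun q => reject (g q) (X q) (reject (g q) (u q) (e 1))
  let Y : F → E3 := fun q => unitize (g q) (Y₀ q)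
  have hX₀p : X₀ p = e 0 := reject_eq_self h.orth_uX
  have hXp : X p = e 0 := by simp only [X, hX₀p, unitize_eq_self h.norm_X]
  have hY₀p : Y₀ p = e 1 := by
    simp only [Y₀, hXp, reject_eq_self h.orth_uY, reject_eq_self h.orth_XY]
  have hYp : Y p = e 1 := by simp only [Y, hY₀p, unitize_eq_self h.norm_Y]
  have hX₀ : ContDiffAt ℝ n X₀ p := contDiffAt_reject hg hu contDiffAt_const hu0
  have hX₀pos : 0 < g p (X₀ p) (X₀ p) := by rw [hX₀p, h.norm_X]; exact one_pos
  have hX : ContDiffAt ℝ n X p := contDiffAt_unitize hg hX₀ hX₀pos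
  have hY₀ : ContDiffAt ℝ n Y₀ p :=
    contDiffAt_reject hg hX (contDiffAt_reject hg hu contDiffAt_const hu0)
      (by rw [hXp, h.norm_X]; exact one_ne_zero)
  have hY₀pos : 0 < g p (Y₀ p) (Y₀ p) := by rw [hY₀p, h.norm_Y]; exact one_pos
  have hY : ContDiffAt ℝ n Y p := contDiffAt_unitize hg hY₀ hY₀pos
  refine ⟨![X, Y], Fin.forall_fin_two.2 ⟨hX, hY⟩, Fin.forall_fin_two.2 ⟨hXp, hYp⟩, ?_⟩
  filter_upwards [((hg.clm_apply hu).clm_apply hu).continuousAt.eventually_ne hu0,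
    ((hg.clm_apply hX₀).clm_apply hX₀).continuousAt.eventually (lt_mem_nhds hX₀pos),
    ((hg.clm_apply hY₀).clm_apply hY₀).continuousAt.eventually (lt_mem_nhds hY₀pos)]
    with q hu hX hY
  exact isComplementaryFrame_gramSchmidt hu rfl rfl hX hY

namespace IsComplementaryFrame

theorem eq_add_sum (h : IsComplementaryFrame b u (e 0) (e 1)) (hb : ∀ v w, b v w = b w v)
    (hu : b u u = 1) (v : E3) : v = b v u • u + ∑ k, b v (e k) • e k := by
  let f : Fin 3 → E3 := ![u, e 0, e 1]
  have hdelta (i j : Fin 3) : b (f i) (f j) = if i = j then 1 else 0 := by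
    fin_cases i <;> fin_cases j <;>
      simp [f, hu, h.norm_X, h.norm_Y, h.orth_XY, h.orth_uX, h.orth_uY, hb (e _) u,
        hb (e 1) (e 0)]
  have hcoord (c : Fin 3 → ℝ) (j : Fin 3) : b (∑ i, c i • f i) (f j) = c j := by
    simp [map_sum, sum_apply, hdelta]
  have hli : LinearIndependent ℝ f := by
    refine Fintype.linearIndependent_iff.2 fun c hc i => ?_
    rw [← hcoord c i, hc, map_zero, zero_apply]
  have hv : v ∈ Submodule.span ℝ (Set.range f) := by
    rw [hli.span_eq_top_of_card_eq_finrank' (by simp)]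
    trivial
  obtain ⟨c, hc⟩ := (Submodule.mem_span_range_iff_exists_fun ℝ).1 hv
  have hbc (j : Fin 3) : b v (f j) = c j := hc ▸ hcoord c j
  calc v = ∑ i, c i • f i := hc.symm
    _ = ∑ i, b v (f i) • f i := by simp only [hbc]
    _ = b v u • u + ∑ k, b v (e k) • e k := by
      simp only [f, Fin.sum_univ_three, Fin.sum_univ_two, Matrix.cons_val, add_assoc]

theorem eq_sum (h : IsComplementaryFrame b u (e 0) (e 1)) (hb : ∀ v w, b v w = b w v)
    (hu : b u u = 1) (hv : b u v = 0) : v = ∑ k, b v (e k) • e k := by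
  simpa only [hb v u, hv, zero_smul, zero_add] using h.eq_add_sum hb hu v

theorem orth (h : IsComplementaryFrame b u (e 0) (e 1)) (i : Fin 2) : b u (e i) = 0 := by
  fin_cases i
  exacts [h.orth_uX, h.orth_uY]

theorem apply_left_eq_sum (h : IsComplementaryFrame b u (e 0) (e 1)) (hb : ∀ v w, b v w = b w v)
    (hu : b u u = 1) (hv : b u v = 0) (B : E3 →L[ℝ] E3 →L[ℝ] ℝ) (w : E3) :
    B v w = ∑ k, b v (e k) * B (e k) w := by
  conv_lhs => rw [h.eq_sum hb hu hv]
  simp only [map_sum, map_smul, sum_apply, smul_apply, smul_eq_mul]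

theorem apply_right_eq_sum (h : IsComplementaryFrame b u (e 0) (e 1)) (hb : ∀ v w, b v w = b w v)
    (hu : b u u = 1) (hw : b u w = 0) (B : E3 →L[ℝ] E3 →L[ℝ] ℝ) (v : E3) :
    B v w = ∑ k, b w (e k) * B v (e k) := by
  conv_lhs => rw [h.eq_sum hb hu hw]
  simp only [map_sum, map_smul, smul_eq_mul]

theorem sum_coord (h : IsComplementaryFrame b u (e 0) (e 1)) (hb : ∀ v w, b v w = b w v)
    (hu : b u u = 1) (L : E3 →ₗ[ℝ] E3) :
    ∑ i : Fin 3, (L (EuclideanSpace.single i 1)) i = b (L u) u + ∑ k, b (L (e k)) (e k) := by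
  have hcoord (v w : E3) : b v w = ∑ i : Fin 3, v i * b (EuclideanSpace.single i 1) w := by
    conv_lhs => rw [← (EuclideanSpace.basisFun (Fin 3) ℝ).sum_repr v]
    simp
  simp only [hcoord (L _)]
  rw [Finset.sum_comm, ← Finset.sum_add_distrib]
  refine Finset.sum_congr rfl fun i _ => ?_
  conv_lhs => rw [h.eq_add_sum hb hu (EuclideanSpace.single i 1)]
  simp [mul_comm]

end IsComplementaryFrame

variable {G : E3 → E3 →L[ℝ] E3 →L[ℝ] ℝ} {p : E3}

theorem IsMetricAt.ricci_eq (hG : IsMetricAt G p) (hu : G p u u = 1)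
    (h : IsComplementaryFrame (G p) u (e 0) (e 1)) (v w : E3) :
    ricci G p v w
      = G p (curvature G p v u u) w + ∑ k, G p (curvature G p v (e k) (e k)) w := by
  have htrace := h.sum_coord (hG.symm p) hu (hG.isLinearMap_curvature v w).mk'
  simp only [IsLinearMap.mk'_apply, hG.curvature_swap_swap _ v w] at htrace
  exact htrace

/-- In dimension three `u^⊥` is a plane, and the restriction of the curvature to a plane has only
one component. -/
theorem IsMetricAt.exists_ricci_horizontal (hG : IsMetricAt G p) (hu : G p u u = 1)
    (h : IsComplementaryFrame (G p) u (e 0) (e 1)) :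
    ∃ K : ℝ, ∀ v w, G p u v = 0 → G p u w = 0 →
      ricci G p v w = G p (curvature G p v u u) w + K * G p v w := by
  refine ⟨G p (curvature G p (e 1) (e 0) (e 0)) (e 1), fun v w hv hw => ?_⟩
  have hleft (k : Fin 2) : curvature G p v (e k) (e k)
      = ∑ i, G p v (e i) • curvature G p (e i) (e k) (e k) := by
    conv_lhs => rw [h.eq_sum (hG.symm p) hu hv]
    exact (map_sum (hG.isLinearMap_curvature (e k) (e k)).mk' _ _).trans
      (Finset.sum_congr rfl fun i _ => (hG.isLinearMap_curvature (e k) (e k)).map_smul _ _)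
  have hright (k : Fin 2) : G p (curvature G p v (e k) (e k)) w
      = ∑ i, ∑ j, G p v (e i) * (G p w (e j) * G p (curvature G p (e i) (e k) (e k)) (e j)) := by
    rw [hleft, h.apply_right_eq_sum (hG.symm p) hu hw]
    simp only [map_sum, map_smul, sum_apply, smul_apply, smul_eq_mul, Finset.mul_sum]
    rw [Finset.sum_comm]
    exact Finset.sum_congr rfl fun i _ => Finset.sum_congr rfl fun j _ => by ring
  have hmetric := h.apply_right_eq_sum (hG.symm p) hu hw (G p) v
  rw [hG.ricci_eq hu h, hmetric]
  simp only [hright, Fin.sum_univ_two, curvature_self_left, hG.curvature_self_right, map_zero,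
    zero_apply, hG.curvature_swap_swap (e 0) (e 1) (e 1) (e 0)]
  ring

end Frames

section Riccati

open Matrix

/-- The matrix of a bilinear form in a frame. -/
def frameMatrix {ι E : Type*} [NormedAddCommGroup E] [NormedSpace ℝ E] (B : E →L[ℝ] E →L[ℝ] ℝ)
    (e : ι → E) : Matrix ι ι ℝ :=
  .of fun i j => B (e i) (e j)

/-- On the `b`-orthogonal complement of `u` the form `B` is a multiple of `b`. -/
def IsUmbilic {E : Type*} [NormedAddCommGroup E] [NormedSpace ℝ E] (b : E →L[ℝ] E →L[ℝ] ℝ) (u : E)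
    (B : E →L[ℝ] E →L[ℝ] ℝ) : Prop :=
  ∃ a : ℝ, ∀ v w, b u v = 0 → b u w = 0 → B v w = a * b v w

/-- The components of the shear and the twist of a deformation with matrix `B`: the trace-free
symmetric and the skew-symmetric part of `B`. -/
def shearTwist (B : Matrix (Fin 2) (Fin 2) ℝ) : Fin 3 → ℝ :=
  ![B 0 0 - B 1 1, B 0 1 + B 1 0, B 0 1 - B 1 0]

/-- The velocity of the matrix `B` of the tensor `g(∇u, ·)` along `∂_t + u`, in a moving orthonormal
frame of `u^⊥`. Here `H` is the matrix of the time derivative of the metric, `L` contains the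
components of the derivatives of the frame, and `K` collects the pure trace terms. -/
def riccatiVelocity (B H L : Matrix (Fin 2) (Fin 2) ℝ) (K : ℝ) : Matrix (Fin 2) (Fin 2) ℝ :=
  - (B * B) + (1 / 4 : ℝ) • (B * H + H * Bᵀ) + L * B + B * Lᵀ + (B.trace / 4) • H + K • 1

/-- The matrix of the linear differential equation that the Riccati equation with the velocity
`riccatiVelocity B H L K` induces on the shear and the twist. -/
def shearTwistGenerator (B H L : Matrix (Fin 2) (Fin 2) ℝ) : Matrix (Fin 3) (Fin 3) ℝ :=
  !![- B.trace - H.trace / 4, L 0 1 - L 1 0, H 0 1 / 2;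
    L 1 0 - L 0 1, - B.trace - H.trace / 4, - (H 0 0 - H 1 1) / 4;
    0, 0, - B.trace - H.trace / 2]

theorem shearTwist_riccatiVelocity {H L : Matrix (Fin 2) (Fin 2) ℝ} (hH : H.IsSymm)
    (hL : H + L + Lᵀ = 0) (B : Matrix (Fin 2) (Fin 2) ℝ) (K : ℝ) :
    shearTwist (riccatiVelocity B H L K) = shearTwistGenerator B H L *ᵥ shearTwist B := by
  have hH10 : H 1 0 = H 0 1 := hH.apply 0 1
  have hL00 : L 0 0 = - H 0 0 / 2 := by
    have h := congrFun₂ hL 0 0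
    simp only [Matrix.add_apply, transpose_apply, Matrix.zero_apply] at h
    linarith
  have hL11 : L 1 1 = - H 1 1 / 2 := by
    have h := congrFun₂ hL 1 1
    simp only [Matrix.add_apply, transpose_apply, Matrix.zero_apply] at h
    linarith
  have hH01 : H 0 1 = - L 0 1 - L 1 0 := by
    have h := congrFun₂ hL 0 1
    simp only [Matrix.add_apply, transpose_apply, Matrix.zero_apply] at h
    linarith
  ext i
  fin_cases i <;>
    simp [shearTwist, riccatiVelocity, shearTwistGenerator, Matrix.mul_apply, trace_fin_two,
      vecHead, vecTail, hH10, hL00, hL11, hH01] <;> ring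

theorem hasDerivWithinAt_shearTwist {B : ℝ → Matrix (Fin 2) (Fin 2) ℝ}
    {B' : Matrix (Fin 2) (Fin 2) ℝ} {S : Set ℝ} {t : ℝ}
    (h : ∀ i j, HasDerivWithinAt (fun s => B s i j) (B' i j) S t) :
    HasDerivWithinAt (fun s => shearTwist (B s)) (shearTwist B') S t := by
  refine hasDerivWithinAt_pi.2 fun i => ?_
  fin_cases i
  exacts [(h 0 0).sub (h 1 1), (h 0 1).add (h 1 0), (h 0 1).sub (h 1 0)]

namespace IsComplementaryFrame

variable {b : E3 →L[ℝ] E3 →L[ℝ] ℝ} {u : E3} {e : Fin 2 → E3}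

theorem frameMatrix_eq_one (h : IsComplementaryFrame b u (e 0) (e 1))
    (hb : ∀ v w, b v w = b w v) : frameMatrix b e = 1 := by
  ext i j
  fin_cases i <;> fin_cases j <;>
    simp [frameMatrix, h.norm_X, h.norm_Y, h.orth_XY, hb (e 1) (e 0)]

theorem isUmbilic_iff (h : IsComplementaryFrame b u (e 0) (e 1)) (hb : ∀ v w, b v w = b w v)
    (hu : b u u = 1) (B : E3 →L[ℝ] E3 →L[ℝ] ℝ) :
    IsUmbilic b u B ↔ shearTwist (frameMatrix B e) = 0 := by
  constructor
  · rintro ⟨a, ha⟩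
    have hB : frameMatrix B e = a • 1 := by
      rw [← h.frameMatrix_eq_one hb]
      ext i j
      exact ha _ _ (h.orth i) (h.orth j)
    ext i
    fin_cases i <;> simp [hB, shearTwist]
  · intro hzero
    have hshear : B (e 0) (e 0) - B (e 1) (e 1) = 0 := congrFun hzero 0
    have hsymm : B (e 0) (e 1) + B (e 1) (e 0) = 0 := congrFun hzero 1
    have htwist : B (e 0) (e 1) - B (e 1) (e 0) = 0 := congrFun hzero 2
    have hB01 : B (e 0) (e 1) = 0 := by linarith
    have hB10 : B (e 1) (e 0) = 0 := by linarith
    refine ⟨B (e 0) (e 0), fun v w hv hw => ?_⟩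
    rw [h.apply_left_eq_sum hb hu hv B, h.apply_right_eq_sum hb hu hw b]
    simp only [h.apply_right_eq_sum hb hu hw B, Fin.sum_univ_two, hB01, hB10,
      ← sub_eq_zero.1 hshear]
    ring

end IsComplementaryFrame

/-- The components of the derivatives of the frame `X` along `∂_t + u`. -/
def connectionMatrix (g : ℝ × E3 → E3 →L[ℝ] E3 →L[ℝ] ℝ) (u : ℝ × E3 → E3)
    (X : Fin 2 → ℝ × E3 → E3) (p : ℝ × E3) : Matrix (Fin 2) (Fin 2) ℝ :=
  .of fun i j => g p (flowDeriv g u (X i) p) (X j p)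

namespace IsFlowAt

variable {g : ℝ × E3 → E3 →L[ℝ] E3 →L[ℝ] ℝ} {u : ℝ × E3 → E3} {X : Fin 2 → ℝ × E3 → E3}
  {e : Fin 2 → E3} {p : ℝ × E3}

theorem exists_fderiv_shape_eq (hf : IsFlowAt g u p)
    (h : IsComplementaryFrame (g p) (u p) (e 0) (e 1)) :
    ∃ K : ℝ, ∀ X Y : ℝ × E3 → E3, DifferentiableAt ℝ X p → DifferentiableAt ℝ Y p →
      g p (u p) (X p) = 0 → g p (u p) (Y p) = 0 →
      fderiv ℝ (fun q => shape g u q (X q) (Y q)) p (1, u p)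
        = - shape g u p (sliceCov g u p (X p)) (Y p)
          + (1 / 4) * (fderiv ℝ g p (1, 0) (sliceCov g u p (X p)) (Y p)
            + fderiv ℝ g p (1, 0) (X p) (sliceCov g u p (Y p)))
          + shape g u p (flowDeriv g u X p) (Y p) + shape g u p (X p) (flowDeriv g u Y p)
          + curvR g u p (X p) (Y p) + K * g p (X p) (Y p) := by
  obtain ⟨K, hK⟩ := hf.slice.exists_ricci_horizontal hf.unit.self_of_nhds h
  refine ⟨K, fun X Y hX hY huX huY => ?_⟩
  rw [hf.fderiv_shape hX hY, hf.curvR_eq, hK _ _ huX huY, hf.covTimeDeriv_symm,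
    hf.fderiv_symm (1, 0) (X p)]
  ring

theorem inner_field_flowDeriv (hf : IsFlowAt g u p) {Y : ℝ × E3 → E3}
    (hY : DifferentiableAt ℝ Y p) (horth : ∀ᶠ q in 𝓝 p, g q (u q) (Y q) = 0) :
    g p (u p) (flowDeriv g u Y p) = 0 := by
  have hderiv := hf.fderiv_metric_flowDeriv (u := u) hf.differentiableAt_field hY
  have hconst : (fun q => g q (u q) (Y q)) =ᶠ[𝓝 p] fun _ => 0 := horth
  rw [hconst.fderiv_eq, fderiv_const_apply, hf.timeDeriv_metric_eq, hf.flowDeriv_field, map_zero,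
    _root_.zero_apply, _root_.zero_apply, zero_add, zero_add] at hderiv
  exact hderiv.symm

theorem add_connectionMatrix_eq_zero (hf : IsFlowAt g u p) (hX : ∀ i, DifferentiableAt ℝ (X i) p)
    (hframe : ∀ᶠ q in 𝓝 p, IsComplementaryFrame (g q) (u q) (X 0 q) (X 1 q)) :
    frameMatrix (fderiv ℝ g p (1, 0)) (X · p) + connectionMatrix g u X p
      + (connectionMatrix g u X p)ᵀ = 0 := by
  ext i j
  have hderiv := hf.fderiv_metric_flowDeriv (u := u) (hX i) (hX j)
  have hconst : (fun q => g q (X i q) (X j q))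
      =ᶠ[𝓝 p] fun _ => (1 : Matrix (Fin 2) (Fin 2) ℝ) i j :=
    hframe.mono fun q hq => congrFun₂ (hq.frameMatrix_eq_one (e := (X · q)) (hf.symm q)) i j
  rw [hconst.fderiv_eq, fderiv_const_apply, hf.symm p (X i p)] at hderiv
  exact hderiv.symm

theorem exists_fderiv_shape_eq_riccatiVelocity (hf : IsFlowAt g u p)
    (hX : ∀ i, DifferentiableAt ℝ (X i) p)
    (hframe : ∀ᶠ q in 𝓝 p, IsComplementaryFrame (g q) (u q) (X 0 q) (X 1 q))
    (hmetric : ∀ v w, g p (u p) v = 0 → g p (u p) w = 0 →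
      (frameMatrix (shape g u p) (X · p)).trace * fderiv ℝ g p (1, 0) v w = 4 * curvR g u p v w) :
    ∃ K : ℝ, ∀ i j, fderiv ℝ (fun q => shape g u q (X i q) (X j q)) p (1, u p)
      = riccatiVelocity (frameMatrix (shape g u p) (X · p))
          (frameMatrix (fderiv ℝ g p (1, 0)) (X · p)) (connectionMatrix g u X p) K i j := by
  have h : IsComplementaryFrame (g p) (u p) (X 0 p) (X 1 p) := hframe.self_of_nhds
  have hone := h.frameMatrix_eq_one (e := (X · p)) (hf.symm p)
  have hunit := hf.unit.self_of_nhds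
  have hcov (i : Fin 2) : g p (u p) (sliceCov g u p (X i p)) = 0 := by
    rw [hf.symm]
    exact hf.shape_field_right _
  have hflow (i : Fin 2) : g p (u p) (flowDeriv g u (X i) p) = 0 :=
    hf.inner_field_flowDeriv (hX i) (hframe.mono fun q hq => hq.orth (e := (X · q)) i)
  have hleft {v : E3} (hv : g p (u p) v = 0) (A : E3 →L[ℝ] E3 →L[ℝ] ℝ) (j : Fin 2) :
      A v (X j p) = ∑ k, g p v (X k p) * A (X k p) (X j p) :=
    h.apply_left_eq_sum (e := (X · p)) (hf.symm p) hunit hv A _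
  have hright {w : E3} (hw : g p (u p) w = 0) (A : E3 →L[ℝ] E3 →L[ℝ] ℝ) (i : Fin 2) :
      A (X i p) w = ∑ k, A (X i p) (X k p) * g p w (X k p) := by
    simp only [h.apply_right_eq_sum (e := (X · p)) (hf.symm p) hunit hw A (X i p), mul_comm]
  obtain ⟨K, hK⟩ := hf.exists_fderiv_shape_eq (e := (X · p)) h
  refine ⟨K, fun i j => ?_⟩
  have hi := h.orth (e := (X · p)) i
  have hj := h.orth (e := (X · p)) j
  have hcurv : curvR g u p (X i p) (X j p) = (frameMatrix (shape g u p) (X · p)).trace / 4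
      * fderiv ℝ g p (1, 0) (X i p) (X j p) := by
    linarith [hmetric _ _ hi hj]
  rw [hK _ _ (hX i) (hX j) hi hj, hcurv, hleft (hcov i), hleft (hcov i), hright (hcov j),
    hleft (hflow i), hright (hflow j)]
  simp only [riccatiVelocity, ← hone, Matrix.add_apply, Matrix.neg_apply, Matrix.smul_apply,
    Matrix.mul_apply, transpose_apply, frameMatrix, connectionMatrix, of_apply, smul_eq_mul,
    shape_apply]

theorem hasDerivWithinAt_shearTwist (hf : IsFlowAt g u p) (hX : ∀ i, DifferentiableAt ℝ (X i) p)
    (hframe : ∀ᶠ q in 𝓝 p, IsComplementaryFrame (g q) (u q) (X 0 q) (X 1 q))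
    (hmetric : ∀ v w, g p (u p) v = 0 → g p (u p) w = 0 →
      (frameMatrix (shape g u p) (X · p)).trace * fderiv ℝ g p (1, 0) v w = 4 * curvR g u p v w)
    {c : ℝ → ℝ × E3} {S : Set ℝ} {s : ℝ} (hs : c s = p) (hc : HasDerivWithinAt c (1, u p) S s) :
    HasDerivWithinAt (fun r => shearTwist (frameMatrix (shape g u (c r)) (X · (c r))))
      (shearTwistGenerator (frameMatrix (shape g u p) (X · p))
        (frameMatrix (fderiv ℝ g p (1, 0)) (X · p)) (connectionMatrix g u X p)
          *ᵥ shearTwist (frameMatrix (shape g u p) (X · p))) S s := by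
  have hsymm : (frameMatrix (fderiv ℝ g p (1, 0)) (X · p)).IsSymm :=
    Matrix.IsSymm.ext fun i j => hf.fderiv_symm _ _ _
  obtain ⟨K, hK⟩ := hf.exists_fderiv_shape_eq_riccatiVelocity hX hframe hmetric
  rw [← shearTwist_riccatiVelocity hsymm (hf.add_connectionMatrix_eq_zero hX hframe) _ K]
  refine NullFlow.hasDerivWithinAt_shearTwist fun i j => ?_
  have hS : DifferentiableAt ℝ (fun q => shape g u q (X i q) (X j q)) p :=
    ((hf.differentiableAt_shape hf.contDiffAt_field).clm_apply (hX i)).clm_apply (hX j)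
  rw [← hK]
  subst hs
  exact hS.hasFDerivAt.comp_hasDerivWithinAt s hc

end IsFlowAt

end Riccati

section Propagation

open scoped Matrix

theorem exists_eventually_norm_mulVec_le {n α : Type*} [Fintype n] {A : α → Matrix n n ℝ}
    {l : Filter α} {B : Matrix n n ℝ} (hA : Filter.Tendsto A l (𝓝 B)) :
    ∃ C, ∀ᶠ s in l, ∀ v, ‖A s *ᵥ v‖ ≤ C * ‖v‖ := by
  open scoped Matrix.Norms.Operator in
  refine ⟨‖B‖ + 1, (hA.norm.eventually (gt_mem_nhds (lt_add_one _))).mono fun s hs v => ?_⟩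
  exact (Matrix.linfty_opNorm_mulVec _ v).trans
    (mul_le_mul_of_nonneg_right hs.le (norm_nonneg v))

theorem eventually_eq_zero_of_hasDerivWithinAt_mulVec {n : Type*} [Fintype n]
    {A : ℝ → Matrix n n ℝ} {f : ℝ → n → ℝ} {a : ℝ} (hA : ContinuousWithinAt A (Ici a) a)
    (hf : ∀ᶠ s in 𝓝[≥] a, HasDerivWithinAt f (A s *ᵥ f s) (Ici a) s) (ha : f a = 0) :
    ∀ᶠ s in 𝓝[≥] a, f s = 0 := by
  obtain ⟨C, hC⟩ := exists_eventually_norm_mulVec_le hA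
  obtain ⟨b, hab, hb⟩ := mem_nhdsGE_iff_exists_Icc_subset.1 (hf.and hC)
  filter_upwards [Icc_mem_nhdsGE hab] with s hs
  have hgronwall := norm_le_gronwallBound_of_norm_deriv_right_le (δ := 0) (K := C) (ε := 0)
    (fun r hr => (hb hr).1.continuousWithinAt.mono Icc_subset_Ici_self)
    (fun r hr => (hb (Ico_subset_Icc_self hr)).1.mono (Ici_subset_Ici.2 hr.1)) (by simp [ha])
    (fun r hr => by simpa using (hb (Ico_subset_Icc_self hr)).2 (f r)) s hs
  rw [gronwallBound_ε0_δ0] at hgronwall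
  exact norm_le_zero_iff.1 hgronwall

theorem continuous_shearTwist : Continuous shearTwist := by
  unfold shearTwist
  fun_prop

theorem continuousAt_shearTwistGenerator {Z : Type*} [TopologicalSpace Z]
    {B H L : Z → Matrix (Fin 2) (Fin 2) ℝ} {p : Z} (hB : ContinuousAt B p) (hH : ContinuousAt H p)
    (hL : ContinuousAt L p) : ContinuousAt (fun q => shearTwistGenerator (B q) (H q) (L q)) p := by
  have hcont : Continuous fun A : Matrix (Fin 2) (Fin 2) ℝ × Matrix (Fin 2) (Fin 2) ℝ ×
      Matrix (Fin 2) (Fin 2) ℝ => shearTwistGenerator A.1 A.2.1 A.2.2 := by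
    refine continuous_matrix fun i j => ?_
    fin_cases i <;> fin_cases j <;>
      simp only [shearTwistGenerator, Matrix.trace_fin_two, Matrix.of_apply, Fin.isValue,
        Fin.zero_eta, Fin.mk_one, Fin.reduceFinMk, Matrix.cons_val] <;>
      fun_prop
  exact (hcont.continuousAt (x := (B p, H p, L p))).comp (f := fun q => (B q, H q, L q))
    (hB.prodMk (hH.prodMk hL))

theorem continuousAt_frameMatrix {Z ι E : Type*} [TopologicalSpace Z] [NormedAddCommGroup E]
    [NormedSpace ℝ E] {B : Z → E →L[ℝ] E →L[ℝ] ℝ} {X : ι → Z → E} {p : Z}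
    (hB : ContinuousAt B p) (hX : ∀ i, ContinuousAt (X i) p) :
    ContinuousAt (fun q => frameMatrix (B q) (X · q)) p :=
  continuousAt_pi.2 fun i => continuousAt_pi.2 fun j => (hB.clm_apply (hX i)).clm_apply (hX j)

theorem IsMetricAt.continuousAt_connectionMatrix {g : ℝ × E3 → E3 →L[ℝ] E3 →L[ℝ] ℝ}
    {u : ℝ × E3 → E3} {X : Fin 2 → ℝ × E3 → E3} {p : ℝ × E3} (hg : IsMetricAt g p)
    (hu : ContinuousAt u p) (hX : ∀ i, ContDiffAt ℝ 1 (X i) p) :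
    ContinuousAt (connectionMatrix g u X) p := by
  refine continuousAt_pi.2 fun i => continuousAt_pi.2 fun j => ?_
  have hflow : ContinuousAt (flowDeriv g u (X i)) p :=
    (((hX i).continuousAt_fderiv (by norm_num)).clm_apply (continuousAt_const.prodMk hu)).add
      ((hg.differentiableAt_sliceChristoffel.continuousAt.clm_apply hu).clm_apply
        (hX i).continuousAt)
  exact (hg.differentiableAt.continuousAt.clm_apply hflow).clm_apply (hX j).continuousAt

theorem nu_slice {g : ℝ × E3 → E3 →L[ℝ] E3 →L[ℝ] ℝ} {u : ℝ × E3 → E3} {p : ℝ × E3}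
    (hg : DifferentiableAt ℝ g p) (hu : DifferentiableAt ℝ u p) (e : Fin 2 → E3) :
    nu (fun z => g (p.1, z)) (fun z => u (p.1, z)) p.2 (e 0) (e 1)
      = - (frameMatrix (shape g u p) e).trace := by
  simp only [nu, cov_slice hg hu, Matrix.trace_fin_two, frameMatrix, Matrix.of_apply, shape_apply]

theorem rho_slice_of_isUmbilic {g : ℝ × E3 → E3 →L[ℝ] E3 →L[ℝ] ℝ} {u : ℝ × E3 → E3} {p : ℝ × E3}
    {e : Fin 2 → E3} (hg : IsMetricAt g p) (hu : DifferentiableAt ℝ u p)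
    (hframe : IsComplementaryFrame (g p) (u p) (e 0) (e 1))
    (humbilic : IsUmbilic (g p) (u p) (shape g u p)) :
    rho (fun z => g (p.1, z)) (fun z => u (p.1, z)) p.2 (e 0) (e 1)
      = (frameMatrix (shape g u p) e).trace := by
  obtain ⟨a, ha⟩ := humbilic
  have htwist : shape g u p (e 1) (e 0) = shape g u p (e 0) (e 1) := by
    rw [ha _ _ (hframe.orth 1) (hframe.orth 0), ha _ _ (hframe.orth 0) (hframe.orth 1), hg.symm]
  simp only [rho, cov_slice hg.differentiableAt hu, Matrix.trace_fin_two, frameMatrix,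
    Matrix.of_apply, ← shape_apply, htwist, sub_self, Complex.ofReal_zero, zero_mul, add_zero]

/-- The evolution equations on `I × O`, where `O` is an open part of the range of a chart. -/
structure IsLocalFlow (I : Set ℝ) (O : Set E3) (g : ℝ × E3 → E3 →L[ℝ] E3 →L[ℝ] ℝ)
    (u : ℝ × E3 → E3) : Prop where
  isOpen : IsOpen O
  contDiffAt_metric : ∀ p ∈ I ×ˢ O, ContDiffAt ℝ 2 g p
  contDiffAt_field : ∀ p ∈ I ×ˢ O, ContDiffAt ℝ 2 u p
  symm : ∀ p v w, g p v w = g p w v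
  pos : ∀ p ∈ I ×ˢ O, ∀ v, v ≠ 0 → 0 < g p v v
  unit : ∀ p ∈ I ×ˢ O, g p (u p) (u p) = 1
  field_eq : ∀ p ∈ I ×ˢ O, deriv (fun s => u (s, p.2)) p.1
    = - cov (fun z => g (p.1, z)) (fun z => u (p.1, z)) p.2 (u p)
  metric_eq : ∀ p ∈ I ×ˢ O, ∀ X Y : E3, IsComplementaryFrame (g p) (u p) X Y →
    nu (fun z => g (p.1, z)) (fun z => u (p.1, z)) p.2 X Y ≠ 0 →
    ∀ v w : E3, deriv (fun s => g (s, p.2) v w) p.1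
      = - (4 / nu (fun z => g (p.1, z)) (fun z => u (p.1, z)) p.2 X Y) * curvRPerp g u p v w

namespace IsLocalFlow

variable {I : Set ℝ} {O : Set E3} {g : ℝ × E3 → E3 →L[ℝ] E3 →L[ℝ] ℝ} {u : ℝ × E3 → E3}
  {e : Fin 2 → E3} {p : ℝ × E3}

theorem isMetricAt (h : IsLocalFlow I O g u) (hp : p ∈ I ×ˢ O) : IsMetricAt g p :=
  ⟨h.contDiffAt_metric p hp, h.symm, isInvertible_of_pos (h.pos p hp)⟩

theorem trace_mul_timeDeriv_metric (h : IsLocalFlow I O g u) (hp : p ∈ I ×ˢ O)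
    (hframe : IsComplementaryFrame (g p) (u p) (e 0) (e 1))
    (htrace : (frameMatrix (shape g u p) e).trace ≠ 0) (v w : E3) :
    (frameMatrix (shape g u p) e).trace * fderiv ℝ g p (1, 0) v w = 4 * curvRPerp g u p v w := by
  have hg := (h.isMetricAt hp).differentiableAt
  have hnu := nu_slice hg ((h.contDiffAt_field p hp).differentiableAt (by norm_num)) e
  have heq := h.metric_eq p hp _ _ hframe (by rwa [hnu, neg_ne_zero]) v w
  rw [hnu, deriv_slice ((hg.clm_apply (differentiableAt_const v)).clm_apply
    (differentiableAt_const w)), fderiv_bilin_apply hg] at heq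
  rw [heq]
  field_simp

theorem trace_mul_timeDeriv_metric_horizontal (h : IsLocalFlow I O g u) (hp : p ∈ I ×ˢ O)
    (hframe : IsComplementaryFrame (g p) (u p) (e 0) (e 1))
    (htrace : (frameMatrix (shape g u p) e).trace ≠ 0) (v w : E3) (hv : g p (u p) v = 0)
    (hw : g p (u p) w = 0) :
    (frameMatrix (shape g u p) e).trace * fderiv ℝ g p (1, 0) v w = 4 * curvR g u p v w := by
  rw [h.trace_mul_timeDeriv_metric hp hframe htrace, curvRPerp, hv, hw]
  ring

theorem timeDeriv_metric_field (h : IsLocalFlow I O g u) (hp : p ∈ I ×ˢ O)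
    (hframe : IsComplementaryFrame (g p) (u p) (e 0) (e 1))
    (htrace : (frameMatrix (shape g u p) e).trace ≠ 0) (w : E3) :
    fderiv ℝ g p (1, 0) (u p) w = 0 := by
  have hperp : curvRPerp g u p (u p) w = 0 := by
    rw [curvRPerp, h.unit p hp]
    ring
  have hmul := h.trace_mul_timeDeriv_metric hp hframe htrace (u p) w
  rw [hperp, mul_zero] at hmul
  exact (mul_eq_zero.1 hmul).resolve_left htrace

theorem exists_frame (h : IsLocalFlow I O g u) (hp : p ∈ I ×ˢ O)
    (hframe : IsComplementaryFrame (g p) (u p) (e 0) (e 1)) :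
    ∃ X : Fin 2 → ℝ × E3 → E3, (∀ i, ContDiffAt ℝ 2 (X i) p) ∧ (∀ i, X i p = e i) ∧
      (∀ᶠ q in 𝓝 p, IsComplementaryFrame (g q) (u q) (X 0 q) (X 1 q)) ∧
      ContinuousAt (fun q => frameMatrix (shape g u q) (X · q)) p := by
  obtain ⟨X, hX, hXp, hX_frame⟩ := exists_contDiffAt_frame (h.contDiffAt_metric p hp)
    (h.contDiffAt_field p hp) (by rw [h.unit p hp]; exact one_ne_zero) hframe
  exact ⟨X, hX, hXp, hX_frame, continuousAt_frameMatrix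
    ((h.isMetricAt hp).differentiableAt_shape (h.contDiffAt_field p hp)).continuousAt
    fun i => (hX i).continuousAt⟩

theorem isFlowAt (h : IsLocalFlow I O g u) (hp : p ∈ I ×ˢ O)
    (hframe : IsComplementaryFrame (g p) (u p) (e 0) (e 1))
    (htrace : (frameMatrix (shape g u p) e).trace ≠ 0) : IsFlowAt g u p := by
  obtain ⟨X, -, hXp, hX_frame, hX_shape⟩ := h.exists_frame hp hframe
  have hX_trace : ∀ᶠ q in 𝓝 p, (frameMatrix (shape g u q) (X · q)).trace ≠ 0 := by
    refine (continuous_id.matrix_trace.continuousAt.comp hX_shape).eventually_ne ?_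
    simpa only [Function.comp_apply, id_eq, hXp] using htrace
  have hslice : ∀ᶠ z in 𝓝 p.2, (p.1, z) ∈ I ×ˢ O :=
    (h.isOpen.eventually_mem hp.2).mono fun z hz => ⟨hp.1, hz⟩
  refine ⟨h.isMetricAt hp, h.contDiffAt_field p hp, hslice.mono fun z => h.unit _, ?_, ?_⟩
  · filter_upwards [hslice] with z hz
    have hu := (h.contDiffAt_field _ hz).differentiableAt (by norm_num)
    rw [← deriv_slice hu, ← cov_slice (h.isMetricAt hz).differentiableAt hu]
    exact h.field_eq _ hz
  · filter_upwards [hslice, (tendsto_slice p).eventually hX_frame,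
      (tendsto_slice p).eventually hX_trace] with z hz hz_frame hz_trace
    exact h.timeDeriv_metric_field hz hz_frame hz_trace

theorem exists_linear_equation (h : IsLocalFlow I O g u) (hp : p ∈ I ×ˢ O)
    (hframe : IsComplementaryFrame (g p) (u p) (e 0) (e 1))
    (htrace : (frameMatrix (shape g u p) e).trace ≠ 0) :
    ∃ (f : ℝ × E3 → Fin 3 → ℝ) (A : ℝ × E3 → Matrix (Fin 3) (Fin 3) ℝ), ContinuousAt A p ∧
      ∀ᶠ q in 𝓝 p, q ∈ I ×ˢ O → (IsUmbilic (g q) (u q) (shape g u q) ↔ f q = 0) ∧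
        ∀ (c : ℝ → ℝ × E3) (S : Set ℝ) (s : ℝ), c s = q → HasDerivWithinAt c (1, u q) S s →
          HasDerivWithinAt (fun r => f (c r)) (A q *ᵥ f q) S s := by
  have hg := h.isMetricAt hp
  obtain ⟨X, hX, hXp, hX_frame, hX_shape⟩ := h.exists_frame hp hframe
  refine ⟨fun q => shearTwist (frameMatrix (shape g u q) (X · q)),
    fun q => shearTwistGenerator (frameMatrix (shape g u q) (X · q))
      (frameMatrix (fderiv ℝ g q (1, 0)) (X · q)) (connectionMatrix g u X q), ?_, ?_⟩
  · have hdot : ContinuousAt (fun q => fderiv ℝ g q (1, 0)) p :=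
      (differentiableAt_fderiv hg.contDiffAt).continuousAt.clm_apply continuousAt_const
    exact continuousAt_shearTwistGenerator hX_shape
      (continuousAt_frameMatrix hdot fun i => (hX i).continuousAt)
      (hg.continuousAt_connectionMatrix (h.contDiffAt_field _ hp).continuousAt
        fun i => (hX i).of_le (by norm_num))
  · have hX_trace : ∀ᶠ q in 𝓝 p, (frameMatrix (shape g u q) (X · q)).trace ≠ 0 := by
      refine (continuous_id.matrix_trace.continuousAt.comp hX_shape).eventually_ne ?_
      simpa only [Function.comp_apply, id_eq, hXp] using htrace
    have hX_diff : ∀ᶠ q in 𝓝 p, ∀ i, DifferentiableAt ℝ (X i) q :=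
      Filter.eventually_all.2 fun i => ((hX i).eventually (by simp)).mono fun q hq =>
        hq.differentiableAt (by norm_num)
    filter_upwards [hX_frame.eventually_nhds, hX_trace, hX_diff] with q hq_frame hq_trace hq_diff hq
    have hq_frame' := hq_frame.self_of_nhds
    have hflow := h.isFlowAt (e := (X · q)) hq hq_frame' hq_trace
    exact ⟨hq_frame'.isUmbilic_iff (e := (X · q)) (h.symm q) (h.unit q hq) _, fun c S s hs hc =>
      hflow.hasDerivWithinAt_shearTwist hq_diff hq_frame
        (h.trace_mul_timeDeriv_metric_horizontal (e := (X · q)) hq hq_frame' hq_trace) hs hc⟩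

theorem eventually_isUmbilic (h : IsLocalFlow I O g u) {c : ℝ → ℝ × E3} {a : ℝ}
    (hc : ∀ᶠ s in 𝓝[≥] a, c s ∈ I ×ˢ O ∧ HasDerivWithinAt c (1, u (c s)) (Ici a) s)
    (hframe : IsComplementaryFrame (g (c a)) (u (c a)) (e 0) (e 1))
    (htrace : (frameMatrix (shape g u (c a)) e).trace ≠ 0)
    (humbilic : IsUmbilic (g (c a)) (u (c a)) (shape g u (c a))) :
    ∀ᶠ s in 𝓝[≥] a, IsUmbilic (g (c s)) (u (c s)) (shape g u (c s)) := by
  obtain ⟨ha, hca⟩ := hc.self_of_nhdsWithin self_mem_Ici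
  obtain ⟨f, A, hA, hf⟩ := h.exists_linear_equation ha hframe htrace
  have hf_curve := hca.continuousWithinAt.eventually hf
  have hzero : ∀ᶠ s in 𝓝[≥] a, f (c s) = 0 := by
    refine eventually_eq_zero_of_hasDerivWithinAt_mulVec
      (ContinuousAt.comp_continuousWithinAt hA hca.continuousWithinAt) ?_
      ((hf.self_of_nhds ha).1.1 humbilic)
    filter_upwards [hc, hf_curve] with s ⟨hs, hcs⟩ hfs
    exact (hfs hs).2 c _ s rfl hcs
  filter_upwards [hc, hf_curve, hzero] with s hs hfs hs_zero
  exact (hfs hs.1).1.2 hs_zero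

theorem isUmbilic_of_tendsto (h : IsLocalFlow I O g u) (hp : p ∈ I ×ˢ O) {α : Type*}
    {l : Filter α} [l.NeBot] {c : α → ℝ × E3} (hc : Filter.Tendsto c l (𝓝 p))
    (hmem : ∀ᶠ s in l, c s ∈ I ×ˢ O)
    (humbilic : ∀ᶠ s in l, IsUmbilic (g (c s)) (u (c s)) (shape g u (c s))) :
    IsUmbilic (g p) (u p) (shape g u p) := by
  obtain ⟨x, y, hframe⟩ := exists_isComplementaryFrame (h.pos p hp)
    (by rw [h.unit p hp]; exact one_ne_zero)
  obtain ⟨X, -, -, hX_frame, hX_shape⟩ := h.exists_frame (e := ![x, y]) hp hframe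
  rw [hX_frame.self_of_nhds.isUmbilic_iff (e := (X · p)) (h.symm p) (h.unit p hp)]
  refine tendsto_nhds_unique ((continuous_shearTwist.continuousAt.comp hX_shape).tendsto.comp hc)
    (tendsto_const_nhds.congr' ?_)
  filter_upwards [hmem, humbilic, hc.eventually hX_frame] with s hs hs_umbilic hs_frame
  exact ((hs_frame.isUmbilic_iff (e := (X · (c s))) (h.symm _) (h.unit _ hs) _).1 hs_umbilic).symm

end IsLocalFlow

end Propagation

section Charts

variable {E : Type*} [NormedAddCommGroup E] [NormedSpace ℝ E]
variable {M : Type*} [TopologicalSpace M] [ChartedSpace E M] {φ : OpenPartialHomeomorph M E}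
variable {V W : (x : M) → TangentSpace 𝓘(ℝ, E) x} {x : M} {y : E}

theorem mdifferentiable_of_mem_maximalAtlas (hφ : φ ∈ IsManifold.maximalAtlas 𝓘(ℝ, E) ∞ M) :
    φ.MDifferentiable 𝓘(ℝ, E) 𝓘(ℝ, E) :=
  ⟨(contMDiffOn_of_mem_maximalAtlas hφ).mdifferentiableOn (by simp),
    (contMDiffOn_symm_of_mem_maximalAtlas hφ).mdifferentiableOn (by simp)⟩

theorem isInvertible_mfderiv_chart (hφ : φ ∈ IsManifold.maximalAtlas 𝓘(ℝ, E) ∞ M)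
    (hx : x ∈ φ.source) : (mfderiv 𝓘(ℝ, E) 𝓘(ℝ, E) φ x).IsInvertible :=
  ⟨(mdifferentiable_of_mem_maximalAtlas hφ).mfderiv hx, rfl⟩

theorem isInvertible_mfderiv_chart_symm (hφ : φ ∈ IsManifold.maximalAtlas 𝓘(ℝ, E) ∞ M)
    (hy : y ∈ φ.target) : (mfderiv 𝓘(ℝ, E) 𝓘(ℝ, E) φ.symm y).IsInvertible :=
  ⟨(mdifferentiable_of_mem_maximalAtlas hφ).symm.mfderiv hy, rfl⟩

/-- The vector field `W` on `M` read in the chart `φ`. -/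
def pushField (φ : OpenPartialHomeomorph M E) (W : (x : M) → TangentSpace 𝓘(ℝ, E) x) (y : E) : E :=
  mfderiv 𝓘(ℝ, E) 𝓘(ℝ, E) φ (φ.symm y) (W (φ.symm y))

/-- The vector field on `M` that the chart `φ` reads as `w`. -/
def pullField (φ : OpenPartialHomeomorph M E) (w : E → E) (x : M) : TangentSpace 𝓘(ℝ, E) x :=
  (mfderiv 𝓘(ℝ, E) 𝓘(ℝ, E) φ x).inverse (w (φ x))

theorem pushField_apply (W : (x : M) → TangentSpace 𝓘(ℝ, E) x) (hx : x ∈ φ.source) :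
    pushField φ W (φ x) = mfderiv 𝓘(ℝ, E) 𝓘(ℝ, E) φ x (W x) := by
  rw [pushField, φ.left_inv hx]

theorem mfderiv_eq_fderiv_pushField (hφ : φ ∈ IsManifold.maximalAtlas 𝓘(ℝ, E) ∞ M)
    (W : (x : M) → TangentSpace 𝓘(ℝ, E) x) (hx : x ∈ φ.source) {f : M → ℝ} {F : E → ℝ}
    (hF : DifferentiableAt ℝ F (φ x)) (hf : f =ᶠ[𝓝 x] F ∘ φ) :
    (show ℝ from mfderiv 𝓘(ℝ, E) 𝓘(ℝ, ℝ) f x (W x)) = fderiv ℝ F (φ x) (pushField φ W (φ x)) := by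
  rw [pushField_apply W hx]
  have hcomp := hF.hasFDerivAt.hasMFDerivAt.comp x
    ((mdifferentiable_of_mem_maximalAtlas hφ).mdifferentiableAt hx).hasMFDerivAt
  exact congrArg (fun L : E →L[ℝ] ℝ => L (W x)) (hcomp.congr_of_eventuallyEq hf).mfderiv

theorem mfderiv_symm_pushField (hφ : φ ∈ IsManifold.maximalAtlas 𝓘(ℝ, E) ∞ M)
    (W : (x : M) → TangentSpace 𝓘(ℝ, E) x) (hy : y ∈ φ.target) :
    mfderiv 𝓘(ℝ, E) 𝓘(ℝ, E) φ.symm y (pushField φ W y : E) = W (φ.symm y) := by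
  have hcomp := (mdifferentiable_of_mem_maximalAtlas hφ).symm_comp_deriv (φ.map_target hy)
  rw [φ.right_inv hy] at hcomp
  exact congrArg (fun L : TangentSpace 𝓘(ℝ, E) (φ.symm y) →L[ℝ] TangentSpace 𝓘(ℝ, E) (φ.symm y) =>
    L (W (φ.symm y))) hcomp

theorem pushField_pullField (hφ : φ ∈ IsManifold.maximalAtlas 𝓘(ℝ, E) ∞ M) (w : E → E)
    (hy : y ∈ φ.target) : pushField φ (pullField φ w) y = w y :=
  ((isInvertible_mfderiv_chart hφ (φ.map_target hy)).self_apply_inverse _).trans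
    (congrArg w (φ.right_inv hy))

theorem pullField_pushField (hφ : φ ∈ IsManifold.maximalAtlas 𝓘(ℝ, E) ∞ M)
    (W : (x : M) → TangentSpace 𝓘(ℝ, E) x) (hx : x ∈ φ.source) :
    pullField φ (pushField φ W) x = W x := by
  rw [pullField, pushField_apply W hx]
  exact (isInvertible_mfderiv_chart hφ hx).inverse_apply_self (W x)

theorem mpullback_symm_eq_pushField (hφ : φ ∈ IsManifold.maximalAtlas 𝓘(ℝ, E) ∞ M)
    (W : (x : M) → TangentSpace 𝓘(ℝ, E) x) (hy : y ∈ φ.target) :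
    VectorField.mpullback 𝓘(ℝ, E) 𝓘(ℝ, E) φ.symm W y = pushField φ W y := by
  rw [VectorField.mpullback_apply, ← mfderiv_symm_pushField hφ W hy]
  exact (isInvertible_mfderiv_chart_symm hφ hy).inverse_apply_self _

theorem mpullback_symm_eventuallyEq_pushField (hφ : φ ∈ IsManifold.maximalAtlas 𝓘(ℝ, E) ∞ M)
    (W : (x : M) → TangentSpace 𝓘(ℝ, E) x) (hy : y ∈ φ.target) :
    VectorField.mpullback 𝓘(ℝ, E) 𝓘(ℝ, E) φ.symm W =ᶠ[𝓝 y] pushField φ W :=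
  (φ.open_target.eventually_mem hy).mono fun _ => mpullback_symm_eq_pushField hφ W

theorem contMDiffAt_chart_symm (hφ : φ ∈ IsManifold.maximalAtlas 𝓘(ℝ, E) ∞ M)
    (hx : x ∈ φ.source) : ContMDiffAt 𝓘(ℝ, E) 𝓘(ℝ, E) ∞ φ.symm (φ x) :=
  (contMDiffOn_symm_of_mem_maximalAtlas hφ).contMDiffAt
    (φ.open_target.mem_nhds (φ.map_source hx))

variable [IsManifold 𝓘(ℝ, E) ∞ M] [CompleteSpace E]

theorem contDiffAt_pushField (hφ : φ ∈ IsManifold.maximalAtlas 𝓘(ℝ, E) ∞ M) (hx : x ∈ φ.source)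
    (hW : ContMDiffAt 𝓘(ℝ, E) 𝓘(ℝ, E).tangent ∞
      (fun z => (⟨z, W z⟩ : TangentBundle 𝓘(ℝ, E) M)) x) :
    ContDiffAt ℝ ∞ (pushField φ W) (φ x) := by
  have hpullback := ContMDiffAt.mpullback_vectorField_preimage (m := ∞) (n := ∞) (f := φ.symm)
    (x₀ := φ x) (V := W) (by rwa [φ.left_inv hx]) (contMDiffAt_chart_symm hφ hx)
    (isInvertible_mfderiv_chart_symm hφ (φ.map_source hx)) (by simp)
  rw [contMDiffAt_vectorSpace_iff_contDiffAt] at hpullback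
  exact hpullback.congr_of_eventuallyEq
    (mpullback_symm_eventuallyEq_pushField hφ W (φ.map_source hx)).symm

theorem contMDiffAt_pullField (hφ : φ ∈ IsManifold.maximalAtlas 𝓘(ℝ, E) ∞ M) {w : E → E}
    (hx : x ∈ φ.source) (hw : ContDiffAt ℝ ∞ w (φ x)) :
    ContMDiffAt 𝓘(ℝ, E) 𝓘(ℝ, E).tangent ∞
      (fun z => (⟨z, pullField φ w z⟩ : TangentBundle 𝓘(ℝ, E) M)) x :=
  ContMDiffAt.mpullback_vectorField_preimage (m := ∞) (n := ∞)
    (contMDiffAt_vectorSpace_iff_contDiffAt.2 hw)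
    ((contMDiffOn_of_mem_maximalAtlas hφ).contMDiffAt (φ.open_source.mem_nhds hx))
    (isInvertible_mfderiv_chart hφ hx) (by simp)

theorem contMDiffAt_of_pushField (hφ : φ ∈ IsManifold.maximalAtlas 𝓘(ℝ, E) ∞ M)
    (hx : x ∈ φ.source) (hW : ContDiffAt ℝ ∞ (pushField φ W) (φ x)) :
    ContMDiffAt 𝓘(ℝ, E) 𝓘(ℝ, E).tangent ∞
      (fun z => (⟨z, W z⟩ : TangentBundle 𝓘(ℝ, E) M)) x := by
  refine (contMDiffAt_pullField hφ hx hW).congr_of_eventuallyEq ?_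
  filter_upwards [φ.open_source.mem_nhds hx] with z hz
  rw [pullField_pushField hφ W hz]

theorem pushField_mlieBracket (hφ : φ ∈ IsManifold.maximalAtlas 𝓘(ℝ, E) ∞ M) (hx : x ∈ φ.source)
    (hW : ContMDiffAt 𝓘(ℝ, E) 𝓘(ℝ, E).tangent ∞
      (fun z => (⟨z, W z⟩ : TangentBundle 𝓘(ℝ, E) M)) x)
    (hV : ContMDiffAt 𝓘(ℝ, E) 𝓘(ℝ, E).tangent ∞
      (fun z => (⟨z, V z⟩ : TangentBundle 𝓘(ℝ, E) M)) x) :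
    pushField φ (VectorField.mlieBracket 𝓘(ℝ, E) W V) (φ x)
      = VectorField.lieBracket ℝ (pushField φ W) (pushField φ V) (φ x) := by
  have hy := φ.map_source hx
  have : IsManifold 𝓘(ℝ, E) (minSmoothness ℝ 2) M := by
    rw [minSmoothness_of_isRCLikeNormedField]
    infer_instance
  rw [← mpullback_symm_eq_pushField hφ _ hy, VectorField.mpullback_mlieBracket (n := ∞)
    (by rw [φ.left_inv hx]; exact hW.mdifferentiableAt (by simp))
    (by rw [φ.left_inv hx]; exact hV.mdifferentiableAt (by simp)) (contMDiffAt_chart_symm hφ hx)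
    (by rw [minSmoothness_of_isRCLikeNormedField]; exact ENat.LEInfty.out),
    ← VectorField.mlieBracketWithin_univ, VectorField.mlieBracketWithin_eq_lieBracketWithin]
  exact (congrFun VectorField.lieBracketWithin_univ (φ x)).trans <|
    (mpullback_symm_eventuallyEq_pushField hφ W hy).lieBracket_vectorField_eq
      (mpullback_symm_eventuallyEq_pushField hφ V hy)

end Charts

section Manifold

variable {M : Type*} [TopologicalSpace M] [ChartedSpace E3 M] {φ : OpenPartialHomeomorph M E3}
  {I : Set ℝ} {g : ℝ → Bundle.RiemannianMetric (fun x : M => TangentSpace (𝓡 3) x)}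
  {U : ℝ → (x : M) → TangentSpace (𝓡 3) x} {t : ℝ} {x : M} {y : E3}

theorem metricIn_symm (p : ℝ × E3) (v w : E3) : metricIn g φ p v w = metricIn g φ p w v :=
  (g p.1).symm (φ.symm p.2) _ _

theorem metricIn_pos (hφ : φ ∈ IsManifold.maximalAtlas (𝓡 3) ∞ M) {p : ℝ × E3}
    (hp : p.2 ∈ φ.target) (v : E3) (hv : v ≠ 0) : 0 < metricIn g φ p v v :=
  (g p.1).pos (φ.symm p.2) (mfderiv (𝓡 3) (𝓡 3) φ.symm p.2 v) fun h =>
    hv ((isInvertible_mfderiv_chart_symm hφ hp).bijective.1 (h.trans (map_zero _).symm))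

theorem metricIn_pushField (hφ : φ ∈ IsManifold.maximalAtlas (𝓡 3) ∞ M) (t : ℝ)
    (W V : (x : M) → TangentSpace (𝓡 3) x) (hy : y ∈ φ.target) :
    metricIn g φ (t, y) (pushField φ W y) (pushField φ V y)
      = (g t).inner (φ.symm y) (W (φ.symm y)) (V (φ.symm y)) := by
  rw [← mfderiv_symm_pushField hφ W hy, ← mfderiv_symm_pushField hφ V hy]
  rfl

theorem inner_eq_metricIn (hφ : φ ∈ IsManifold.maximalAtlas (𝓡 3) ∞ M) (t : ℝ)
    (W V : (x : M) → TangentSpace (𝓡 3) x) (hx : x ∈ φ.source) :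
    (g t).inner x (W x) (V x)
      = metricIn g φ (t, φ x) (pushField φ W (φ x)) (pushField φ V (φ x)) := by
  rw [metricIn_pushField hφ t W V (φ.map_source hx), φ.left_inv hx]

namespace IsEvolvingTriple

theorem isMetricAt (htriple : IsEvolvingTriple I g U)
    (hφ : φ ∈ IsManifold.maximalAtlas (𝓡 3) ∞ M) (ht : t ∈ I) (hy : y ∈ φ.target) :
    IsMetricAt (metricIn g φ) (t, y) where
  contDiffAt := (htriple.smooth_metric φ hφ t ht y hy).of_le ENat.LEInfty.out
  symm := metricIn_symm
  isInvertible := isInvertible_of_pos (metricIn_pos hφ hy)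

theorem contDiffAt_pushField (htriple : IsEvolvingTriple I g U)
    (hφ : φ ∈ IsManifold.maximalAtlas (𝓡 3) ∞ M) (ht : t ∈ I) (hx : x ∈ φ.source) :
    ContDiffAt ℝ ∞ (pushField φ (U t)) (φ x) :=
  contDiffAt_slice (p := (t, φ x)) (htriple.smooth_field φ hφ t ht _ (φ.map_source hx))

theorem metricIn_cov (htriple : IsEvolvingTriple I g U)
    (hφ : φ ∈ IsManifold.maximalAtlas (𝓡 3) ∞ M) (ht : t ∈ I) (hx : x ∈ φ.source) (v w : E3) :
    metricIn g φ (t, φ x)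
        (cov (fun z => metricIn g φ (t, z)) (pushField φ (U t)) (φ x) v) w
      = shape (metricIn g φ) (fieldIn U φ) (t, φ x) v w := by
  have hy := φ.map_source hx
  rw [shape_apply, ← cov_slice (htriple.isMetricAt hφ ht hy).differentiableAt
    ((htriple.smooth_field φ hφ t ht _ hy).differentiableAt (by simp))]
  rfl

theorem lieDerivMetric_eq_shape [IsManifold (𝓡 3) ∞ M] (htriple : IsEvolvingTriple I g U)
    (hφ : φ ∈ IsManifold.maximalAtlas (𝓡 3) ∞ M) (ht : t ∈ I) (hx : x ∈ φ.source)
    {X Y : (x : M) → TangentSpace (𝓡 3) x}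
    (hX : ContMDiffAt (𝓡 3) (𝓡 3).tangent ∞ (fun z => (⟨z, X z⟩ : TangentBundle (𝓡 3) M)) x)
    (hY : ContMDiffAt (𝓡 3) (𝓡 3).tangent ∞ (fun z => (⟨z, Y z⟩ : TangentBundle (𝓡 3) M)) x) :
    lieDerivMetric (g t) (U t) X Y x
      = shape (metricIn g φ) (fieldIn U φ) (t, φ x) (pushField φ X (φ x)) (pushField φ Y (φ x))
        + shape (metricIn g φ) (fieldIn U φ) (t, φ x) (pushField φ Y (φ x))
            (pushField φ X (φ x)) := by
  have hg := (htriple.isMetricAt hφ ht (φ.map_source hx)).slice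
  have hU := contMDiffAt_of_pushField hφ hx (htriple.contDiffAt_pushField hφ ht hx)
  have hX' := (NullFlow.contDiffAt_pushField hφ hx hX).differentiableAt (by simp)
  have hY' := (NullFlow.contDiffAt_pushField hφ hx hY).differentiableAt (by simp)
  have hinner : (fun z => (g t).inner z (X z) (Y z)) =ᶠ[𝓝 x]
      (fun y => metricIn g φ (t, y) (pushField φ X y) (pushField φ Y y)) ∘ φ :=
    (φ.open_source.eventually_mem hx).mono fun z hz => inner_eq_metricIn hφ t X Y hz
  rw [← htriple.metricIn_cov hφ ht hx, ← htriple.metricIn_cov hφ ht hx, lieDerivMetric,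
    mfderiv_eq_fderiv_pushField hφ (U t) hx
      ((hg.differentiableAt.clm_apply hX').clm_apply hY') hinner,
    inner_eq_metricIn hφ t (VectorField.mlieBracket (𝓡 3) (U t) X) Y hx,
    inner_eq_metricIn hφ t X (VectorField.mlieBracket (𝓡 3) (U t) Y) hx,
    pushField_mlieBracket hφ hx hU hX, pushField_mlieBracket hφ hx hU hY]
  exact hg.lieDeriv_eq_cov hX' hY'

end IsEvolvingTriple

theorem IsHorizontalNear.eventually_metricIn_eq_zero [IsManifold (𝓡 3) ∞ M]
    {Z : (x : M) → TangentSpace (𝓡 3) x} (hZ : IsHorizontalNear (g t) (U t) Z x)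
    (hφ : φ ∈ IsManifold.maximalAtlas (𝓡 3) ∞ M) (hx : x ∈ φ.source) :
    ∀ᶠ y in 𝓝 (φ x), metricIn g φ (t, y) (pushField φ (U t) y) (pushField φ Z y) = 0 := by
  have hy := φ.map_source hx
  have hsymm : Filter.Tendsto φ.symm (𝓝 (φ x)) (𝓝 x) := by
    simpa only [φ.left_inv hx] using (φ.continuousAt_symm hy).tendsto
  filter_upwards [hsymm.eventually hZ.2, φ.open_target.eventually_mem hy] with y hy_orth hy
  rw [metricIn_pushField hφ t _ _ hy, hy_orth]

namespace IsEvolvingTriple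

theorem inner_mlieBracket_eq_shape [IsManifold (𝓡 3) ∞ M] (htriple : IsEvolvingTriple I g U)
    (hφ : φ ∈ IsManifold.maximalAtlas (𝓡 3) ∞ M) (ht : t ∈ I) (hx : x ∈ φ.source)
    {X Y : (x : M) → TangentSpace (𝓡 3) x}
    (hX : IsHorizontalNear (g t) (U t) X x) (hY : IsHorizontalNear (g t) (U t) Y x) :
    (g t).inner x (U t x) (VectorField.mlieBracket (𝓡 3) X Y x)
      = shape (metricIn g φ) (fieldIn U φ) (t, φ x) (pushField φ Y (φ x)) (pushField φ X (φ x))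
        - shape (metricIn g φ) (fieldIn U φ) (t, φ x) (pushField φ X (φ x))
            (pushField φ Y (φ x)) := by
  have hg := (htriple.isMetricAt hφ ht (φ.map_source hx)).slice
  rw [← htriple.metricIn_cov hφ ht hx, ← htriple.metricIn_cov hφ ht hx,
    inner_eq_metricIn hφ t (U t) (VectorField.mlieBracket (𝓡 3) X Y) hx,
    pushField_mlieBracket hφ hx hX.1 hY.1]
  exact hg.inner_lieBracket_eq_cov
    ((htriple.contDiffAt_pushField hφ ht hx).differentiableAt (by simp))
    ((NullFlow.contDiffAt_pushField hφ hx hX.1).differentiableAt (by simp))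
    ((NullFlow.contDiffAt_pushField hφ hx hY.1).differentiableAt (by simp))
    (hX.eventually_metricIn_eq_zero hφ hx) (hY.eventually_metricIn_eq_zero hφ hx)

theorem exists_isHorizontalNear [IsManifold (𝓡 3) ∞ M] (htriple : IsEvolvingTriple I g U)
    (hφ : φ ∈ IsManifold.maximalAtlas (𝓡 3) ∞ M) (ht : t ∈ I) (hx : x ∈ φ.source) {v : E3}
    (hv : metricIn g φ (t, φ x) (fieldIn U φ (t, φ x)) v = 0) :
    ∃ X, IsHorizontalNear (g t) (U t) X x ∧ pushField φ X (φ x) = v := by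
  have hy := φ.map_source hx
  have hg := contDiffAt_slice (p := (t, φ x)) (htriple.smooth_metric φ hφ t ht _ hy)
  have hU := htriple.contDiffAt_pushField hφ ht hx
  have hunit {z : M} (hz : z ∈ φ.source) :
      metricIn g φ (t, φ z) (pushField φ (U t) (φ z)) (pushField φ (U t) (φ z)) = 1 := by
    rw [← inner_eq_metricIn hφ t _ _ hz, htriple.unit t ht z]
  let w : E3 → E3 := fun y =>
    v - metricIn g φ (t, y) (pushField φ (U t) y) v • pushField φ (U t) y
  have hw : ContDiffAt ℝ ∞ w (φ x) :=
    contDiffAt_const.sub (((hg.clm_apply hU).clm_apply contDiffAt_const).smul hU)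
  refine ⟨pullField φ w, ⟨contMDiffAt_pullField hφ hx hw, ?_⟩, ?_⟩
  · filter_upwards [φ.open_source.mem_nhds hx] with z hz
    rw [inner_eq_metricIn hφ t _ _ hz, pushField_pullField hφ w (φ.map_source hz)]
    simp only [w, map_sub, map_smul, hunit hz, smul_eq_mul, mul_one, sub_self]
  · rw [pushField_pullField hφ w hy]
    change v - metricIn g φ (t, φ x) (fieldIn U φ (t, φ x)) v • _ = v
    rw [hv, zero_smul, sub_zero]

end IsEvolvingTriple

/-- At the point `x` the foliation tangent to `U` is conformal and `U^⊥` is integrable. -/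
def IsConformalIntegrableAt (g : Bundle.RiemannianMetric (fun x : M => TangentSpace (𝓡 3) x))
    (U : (x : M) → TangentSpace (𝓡 3) x) (x : M) [IsManifold (𝓡 3) ∞ M] : Prop :=
  IsConformalFoliationOn g U {x} ∧ IsIntegrableComplementOn g U {x}

theorem IsEvolvingTriple.isConformalIntegrableAt_iff [IsManifold (𝓡 3) ∞ M]
    (htriple : IsEvolvingTriple I g U) (hφ : φ ∈ IsManifold.maximalAtlas (𝓡 3) ∞ M) (ht : t ∈ I)
    (hx : x ∈ φ.source) :
    IsConformalIntegrableAt (g t) (U t) x ↔ IsUmbilic (metricIn g φ (t, φ x))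
      (fieldIn U φ (t, φ x)) (shape (metricIn g φ) (fieldIn U φ) (t, φ x)) := by
  constructor
  · rintro ⟨⟨a, hconf⟩, hint⟩
    refine ⟨a x / 2, fun v w hv hw => ?_⟩
    obtain ⟨X, hX, rfl⟩ := htriple.exists_isHorizontalNear hφ ht hx hv
    obtain ⟨Y, hY, rfl⟩ := htriple.exists_isHorizontalNear hφ ht hx hw
    have hshear := hconf x rfl X Y hX hY
    have htwist := hint x rfl X Y hX hY
    rw [htriple.lieDerivMetric_eq_shape hφ ht hx hX.1 hY.1, inner_eq_metricIn hφ t _ _ hx]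
      at hshear
    rw [htriple.inner_mlieBracket_eq_shape hφ ht hx hX hY] at htwist
    linarith
  · rintro ⟨a, ha⟩
    have horth {Z : (x : M) → TangentSpace (𝓡 3) x} (hZ : IsHorizontalNear (g t) (U t) Z x) :
        metricIn g φ (t, φ x) (fieldIn U φ (t, φ x)) (pushField φ Z (φ x)) = 0 :=
      (hZ.eventually_metricIn_eq_zero hφ hx).self_of_nhds
    constructor
    · refine ⟨fun _ => 2 * a, ?_⟩
      rintro _ rfl X Y hX hY
      rw [htriple.lieDerivMetric_eq_shape hφ ht hx hX.1 hY.1, inner_eq_metricIn hφ t _ _ hx,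
        ha _ _ (horth hX) (horth hY), ha _ _ (horth hY) (horth hX),
        metricIn_symm _ (pushField φ Y (φ _))]
      ring
    · rintro _ rfl X Y hX hY
      rw [htriple.inner_mlieBracket_eq_shape hφ ht hx hX hY, ha _ _ (horth hX) (horth hY),
        ha _ _ (horth hY) (horth hX), metricIn_symm _ (pushField φ Y (φ _)), sub_self]

theorem IsModifiedRicciFlow.isLocalFlow (hflow : IsModifiedRicciFlow I g U)
    (htriple : IsEvolvingTriple I g U) (hφ : φ ∈ IsManifold.maximalAtlas (𝓡 3) ∞ M) :
    IsLocalFlow I φ.target (metricIn g φ) (fieldIn U φ) where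
  isOpen := φ.open_target
  contDiffAt_metric _ hp := (htriple.isMetricAt hφ hp.1 hp.2).contDiffAt
  contDiffAt_field p hp := (htriple.smooth_field φ hφ p.1 hp.1 p.2 hp.2).of_le ENat.LEInfty.out
  symm := metricIn_symm
  pos _ hp := metricIn_pos hφ hp.2
  unit p hp := (metricIn_pushField hφ p.1 (U p.1) (U p.1) hp.2).trans (htriple.unit p.1 hp.1 _)
  field_eq p hp := hflow.field_eq φ hφ p.1 hp.1 p.2 hp.2
  metric_eq p hp := hflow.metric_eq φ hφ p.1 hp.1 p.2 hp.2

end Manifold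

section IntegralCurves

theorem contDiffAt_of_eventually_hasDerivAt {E : Type*} [NormedAddCommGroup E] [NormedSpace ℝ E]
    [CompleteSpace E] {n : ℕ∞} {v : E → E} {O : Set E} {c : ℝ → E} {s : ℝ} (hv : ContDiffOn ℝ n v O)
    (hc : ∀ᶠ r in 𝓝 s, c r ∈ O ∧ HasDerivAt c (v (c r)) r) : ContDiffAt ℝ n c s := by
  obtain ⟨a, b, -, hab, hsub⟩ := exists_Icc_mem_subset_of_mem_nhds hc
  exact (ODE.contDiffOn_enat_Icc_of_hasDerivWithinAt (f := fun _ => v)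
    (hv.comp contDiffOn_snd fun p hp => hp.2) (fun r hr => (hsub hr).2.hasDerivWithinAt)
    fun r hr => (hsub hr).1).contDiffAt hab

variable {M : Type*} [TopologicalSpace M] [ChartedSpace E3 M] {φ : OpenPartialHomeomorph M E3}
  {I S : Set ℝ} {g : ℝ → Bundle.RiemannianMetric (fun x : M => TangentSpace (𝓡 3) x)}
  {U : ℝ → (x : M) → TangentSpace (𝓡 3) x} {γ : ℝ → ℝ × M} {s t : ℝ}

theorem hasDerivWithinAt_chart (hφ : φ ∈ IsManifold.maximalAtlas (𝓡 3) ∞ M)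
    (hγ : IsMIntegralCurveOn (I := 𝓘(ℝ, ℝ).prod (𝓡 3)) γ (nullField U) S)
    (hs : s ∈ S) (hx : (γ s).2 ∈ φ.source) :
    HasDerivWithinAt (fun r => ((γ r).1, φ (γ r).2))
      (1, fieldIn U φ ((γ s).1, φ (γ s).2)) S s := by
  let L : ℝ →L[ℝ] ℝ × E3 := ContinuousLinearMap.smulRight (1 : ℝ →L[ℝ] ℝ) (1, U (γ s).1 (γ s).2)
  let D : E3 →L[ℝ] E3 := mfderiv (𝓡 3) (𝓡 3) φ (γ s).2
  have hfst : HasFDerivWithinAt (fun r => (γ r).1) ((ContinuousLinearMap.fst ℝ ℝ E3).comp L) S s :=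
    ((hasMFDerivAt_fst (γ s)).comp_hasMFDerivWithinAt s (hγ s hs)).hasFDerivWithinAt
  have hsnd : HasFDerivWithinAt (fun r => φ (γ r).2)
      (D.comp ((ContinuousLinearMap.snd ℝ ℝ E3).comp L)) S s :=
    (((mdifferentiable_of_mem_maximalAtlas hφ).mdifferentiableAt hx).hasMFDerivAt
      |>.comp_hasMFDerivWithinAt s
        ((hasMFDerivAt_snd (γ s)).comp_hasMFDerivWithinAt s (hγ s hs))).hasFDerivWithinAt
  have hfield : fieldIn U φ ((γ s).1, φ (γ s).2) = D (U (γ s).1 (γ s).2) :=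
    pushField_apply (U (γ s).1) hx
  simpa [L, hfield] using (hfst.prodMk hsnd).hasDerivWithinAt

theorem eventually_mem_source
    (hγ : IsMIntegralCurveOn (I := 𝓘(ℝ, ℝ).prod (𝓡 3)) γ (nullField U) S) (hs : s ∈ S)
    (hx : (γ s).2 ∈ φ.source) : ∀ᶠ r in 𝓝[S] s, (γ r).2 ∈ φ.source :=
  (continuousAt_snd.comp_continuousWithinAt (hγ.continuousWithinAt hs)).eventually
    (φ.open_source.mem_nhds hx)

theorem IsModifiedRicciFlow.isFlowAt_of_nuNeZero (hflow : IsModifiedRicciFlow I g U)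
    (htriple : IsEvolvingTriple I g U) (hφ : φ ∈ IsManifold.maximalAtlas (𝓡 3) ∞ M) (ht : t ∈ I)
    {x : M} (hx : x ∈ φ.source) (hν : NuNeZero g U t x) :
    IsFlowAt (metricIn g φ) (fieldIn U φ) (t, φ x) := by
  have hlocal := hflow.isLocalFlow htriple hφ
  have hp : (t, φ x) ∈ I ×ˢ φ.target := ⟨ht, φ.map_source hx⟩
  obtain ⟨X, Y, hframe⟩ := exists_isComplementaryFrame (hlocal.pos _ hp)
    (by rw [hlocal.unit _ hp]; exact one_ne_zero)
  refine hlocal.isFlowAt (e := ![X, Y]) hp hframe ?_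
  rw [← neg_ne_zero, ← nu_slice (hlocal.isMetricAt hp).differentiableAt
    ((hlocal.contDiffAt_field _ hp).differentiableAt (by norm_num))]
  exact hν φ hφ hx X Y hframe

theorem IsModifiedRicciFlow.isNullGeodesicOn (hflow : IsModifiedRicciFlow I g U)
    (htriple : IsEvolvingTriple I g U) (hS : IsOpen S)
    (hγ : IsMIntegralCurveOn (I := 𝓘(ℝ, ℝ).prod (𝓡 3)) γ (nullField U) S)
    (hν : ∀ s ∈ S, (γ s).1 ∈ I ∧ NuNeZero g U (γ s).1 (γ s).2) : IsNullGeodesicOn g γ S := by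
  refine ⟨hγ.continuousOn, fun φ hφ s hs hx => ?_⟩
  intro c
  have hlocal := hflow.isLocalFlow htriple hφ
  have hc : ∀ᶠ r in 𝓝 s, c r ∈ I ×ˢ φ.target ∧ HasDerivAt c (1, fieldIn U φ (c r)) r := by
    filter_upwards [hS.mem_nhds hs, hS.nhdsWithin_eq hs ▸ eventually_mem_source hγ hs hx]
      with r hr hr_source
    exact ⟨⟨(hν r hr).1, φ.map_source hr_source⟩,
      (hasDerivWithinAt_chart hφ hγ hr hr_source).hasDerivAt (hS.mem_nhds hr)⟩
  have hsmooth : ContDiffAt ℝ 2 c s :=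
    contDiffAt_of_eventually_hasDerivAt (n := 2) (v := fun p => (1, fieldIn U φ p))
      (fun p hp => (contDiffAt_const.prodMk (hlocal.contDiffAt_field p hp)).contDiffWithinAt) hc
  have hf : IsFlowAt (metricIn g φ) (fieldIn U φ) (c s) :=
    hflow.isFlowAt_of_nuNeZero htriple hφ (hν s hs).1 hx (hν s hs).2
  obtain ⟨hmem, hvelocity⟩ := hc.self_of_nhds
  have hderiv : deriv c =ᶠ[𝓝 s] fun r => (1, fieldIn U φ (c r)) := hc.mono fun r hr => hr.2.deriv
  have haccel : HasDerivAt (fun r => ((1 : ℝ), fieldIn U φ (c r)))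
      (0, fderiv ℝ (fieldIn U φ) (c s) (1, fieldIn U φ (c s))) s :=
    (hasDerivAt_const s (1 : ℝ)).prodMk
      (hf.differentiableAt_field.hasFDerivAt.comp_hasDerivAt s hvelocity)
  rw [hderiv.deriv_eq, haccel.deriv, hvelocity.deriv]
  refine ⟨hsmooth, hf.geodesic_eq, ?_, fun h => one_ne_zero (congrArg Prod.fst h)⟩
  rw [spacetime_apply, hlocal.unit _ hmem, mul_one, sub_self]

theorem fst_eq_of_isMIntegralCurveOn [IsManifold (𝓡 3) ∞ M]
    (hγ : IsMIntegralCurveOn (I := 𝓘(ℝ, ℝ).prod (𝓡 3)) γ (nullField U) (Icc 0 t))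
    (h0 : (γ 0).1 = 0) (hs : s ∈ Icc 0 t) : (γ s).1 = s := by
  have hderiv (r : ℝ) (hr : r ∈ Icc 0 t) :
      HasDerivWithinAt (fun q => (γ q).1 - q) 0 (Icc 0 t) r := by
    have hchart := hasDerivWithinAt_chart (U := U)
      (IsManifold.chart_mem_maximalAtlas (I := 𝓡 3) (n := ∞) (γ r).2) hγ hr
      (mem_chart_source E3 (γ r).2)
    have hfst : HasDerivWithinAt (fun q => (γ q).1) 1 (Icc 0 t) r :=
      (ContinuousLinearMap.fst ℝ ℝ E3).hasFDerivAt.comp_hasDerivWithinAt r hchart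
    simpa using hfst.fun_sub (hasDerivWithinAt_id r (Icc 0 t))
  have hconst := constant_of_has_deriv_right_zero
    (fun r hr => (hderiv r hr).continuousWithinAt)
    (fun r hr => (hderiv r (Ico_subset_Icc_self hr)).mono_of_mem_nhdsWithin
      (Icc_mem_nhdsGE_of_mem hr)) s hs
  simpa only [h0, sub_zero, sub_eq_zero] using hconst

namespace IsModifiedRicciFlow

variable [IsManifold (𝓡 3) ∞ M]

theorem eventually_isConformalIntegrableAt (hflow : IsModifiedRicciFlow I g U)
    (htriple : IsEvolvingTriple I g U)
    (hγ : IsMIntegralCurveOn (I := 𝓘(ℝ, ℝ).prod (𝓡 3)) γ (nullField U) S)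
    (hI : ∀ r ∈ S, (γ r).1 ∈ I) (hS : S ∈ 𝓝[≥] s) (hρ : RhoNeZero g U (γ s).1 (γ s).2)
    (hconf : IsConformalIntegrableAt (g (γ s).1) (U (γ s).1) (γ s).2) :
    ∀ᶠ r in 𝓝[≥] s, IsConformalIntegrableAt (g (γ r).1) (U (γ r).1) (γ r).2 := by
  have hs : s ∈ S := mem_of_mem_nhdsWithin self_mem_Ici hS
  let φ := chartAt E3 (γ s).2
  have hφ : φ ∈ IsManifold.maximalAtlas (𝓡 3) ∞ M := IsManifold.chart_mem_maximalAtlas _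
  have hx : (γ s).2 ∈ φ.source := mem_chart_source E3 _
  have hlocal := hflow.isLocalFlow htriple hφ
  have hp : ((γ s).1, φ (γ s).2) ∈ I ×ˢ φ.target := ⟨hI s hs, φ.map_source hx⟩
  have humbilic := (htriple.isConformalIntegrableAt_iff hφ (hI s hs) hx).1 hconf
  obtain ⟨X, Y, hframe⟩ := exists_isComplementaryFrame (hlocal.pos _ hp)
    (by rw [hlocal.unit _ hp]; exact one_ne_zero)
  have htrace : (frameMatrix (shape (metricIn g φ) (fieldIn U φ) ((γ s).1, φ (γ s).2))
      ![X, Y]).trace ≠ 0 := by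
    rw [← Complex.ofReal_ne_zero, ← rho_slice_of_isUmbilic (hlocal.isMetricAt hp)
      ((hlocal.contDiffAt_field _ hp).differentiableAt (by norm_num)) hframe humbilic]
    exact hρ φ hφ hx X Y hframe
  have hsource : ∀ᶠ r in 𝓝[≥] s, r ∈ S ∧ (γ r).2 ∈ φ.source :=
    Filter.Eventually.and hS
      ((eventually_mem_source hγ hs hx).filter_mono (nhdsWithin_le_of_mem hS))
  have hcurve : ∀ᶠ r in 𝓝[≥] s, ((γ r).1, φ (γ r).2) ∈ I ×ˢ φ.target ∧ HasDerivWithinAt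
      (fun q => ((γ q).1, φ (γ q).2)) (1, fieldIn U φ ((γ r).1, φ (γ r).2)) (Ici s) r := by
    filter_upwards [hsource, eventually_eventually_nhdsWithin.2 hS] with r ⟨hr, hr_source⟩ hS_near
    exact ⟨⟨hI r hr, φ.map_source hr_source⟩,
      (hasDerivWithinAt_chart hφ hγ hr hr_source).mono_of_mem_nhdsWithin hS_near⟩
  filter_upwards [hsource, hlocal.eventually_isUmbilic hcurve hframe htrace humbilic]
    with r ⟨hr, hr_source⟩ hr_umbilic
  exact (htriple.isConformalIntegrableAt_iff hφ (hI r hr) hr_source).2 hr_umbilic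

theorem isConformalIntegrableAt_of_mem_closure (hflow : IsModifiedRicciFlow I g U)
    (htriple : IsEvolvingTriple I g U)
    (hγ : IsMIntegralCurveOn (I := 𝓘(ℝ, ℝ).prod (𝓡 3)) γ (nullField U) S)
    (hI : ∀ r ∈ S, (γ r).1 ∈ I) (hs : s ∈ S)
    (hclosure : s ∈ closure
      ({r | IsConformalIntegrableAt (g (γ r).1) (U (γ r).1) (γ r).2} ∩ S)) :
    IsConformalIntegrableAt (g (γ s).1) (U (γ s).1) (γ s).2 := by
  let φ := chartAt E3 (γ s).2
  have hφ : φ ∈ IsManifold.maximalAtlas (𝓡 3) ∞ M := IsManifold.chart_mem_maximalAtlas _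
  have hx : (γ s).2 ∈ φ.source := mem_chart_source E3 _
  have := mem_closure_iff_nhdsWithin_neBot.1 hclosure
  have hsource := (eventually_mem_source hγ hs hx).filter_mono
    (nhdsWithin_mono s (inter_subset_right
      (s := {r | IsConformalIntegrableAt (g (γ r).1) (U (γ r).1) (γ r).2})))
  have hcont := (hasDerivWithinAt_chart hφ hγ hs hx).continuousWithinAt.mono
    (inter_subset_right (s := {r | IsConformalIntegrableAt (g (γ r).1) (U (γ r).1) (γ r).2}))
  refine (htriple.isConformalIntegrableAt_iff hφ (hI s hs) hx).2
    ((hflow.isLocalFlow htriple hφ).isUmbilic_of_tendsto ⟨hI s hs, φ.map_source hx⟩ hcont ?_ ?_)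
  · filter_upwards [self_mem_nhdsWithin, hsource] with r hr hr_source
    exact ⟨hI r hr.2, φ.map_source hr_source⟩
  · filter_upwards [self_mem_nhdsWithin, hsource] with r hr hr_source
    exact (htriple.isConformalIntegrableAt_iff hφ (hI r hr.2) hr_source).1 hr.1

theorem isConformalIntegrableAt_of_isMIntegralCurveOn (hflow : IsModifiedRicciFlow I g U)
    (htriple : IsEvolvingTriple I g U) {a b : ℝ}
    (hγ : IsMIntegralCurveOn (I := 𝓘(ℝ, ℝ).prod (𝓡 3)) γ (nullField U) (Icc a b))
    (hI : ∀ s ∈ Icc a b, (γ s).1 ∈ I) (hρ : ∀ s ∈ Ico a b, RhoNeZero g U (γ s).1 (γ s).2)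
    (hinit : IsConformalIntegrableAt (g (γ a).1) (U (γ a).1) (γ a).2) (hs : s ∈ Icc a b) :
    IsConformalIntegrableAt (g (γ s).1) (U (γ s).1) (γ s).2 := by
  refine (IsClosed.Icc_subset_of_forall_mem_nhdsWithin (isClosed_of_closure_subset fun r hr => ?_)
    hinit fun r ⟨hr_conf, hr⟩ => ?_ :
      Icc a b ⊆ {r | IsConformalIntegrableAt (g (γ r).1) (U (γ r).1) (γ r).2}) hs
  · have hr_mem : r ∈ Icc a b := isClosed_Icc.closure_subset_iff.2 inter_subset_right hr
    exact ⟨hflow.isConformalIntegrableAt_of_mem_closure htriple hγ hI hr_mem hr, hr_mem⟩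
  · exact nhdsWithin_mono r Ioi_subset_Ici_self (hflow.eventually_isConformalIntegrableAt htriple
      hγ hI (Icc_mem_nhdsGE_of_mem hr) (hρ r hr) hr_conf)

end IsModifiedRicciFlow

end IntegralCurves

end NullFlow

end

theorem mainTheorem3 {M : Type*} [TopologicalSpace M] [T2Space M] [SecondCountableTopology M]
    [ChartedSpace NullFlow.E3 M] [IsManifold (𝓡 3) ∞ M]
    (I : Set ℝ) (hI : I.OrdConnected) (h0 : (0 : ℝ) ∈ I)
    (g : ℝ → Bundle.RiemannianMetric (fun x : M => TangentSpace (𝓡 3) x))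
    (U : ℝ → (x : M) → TangentSpace (𝓡 3) x)
    (htriple : NullFlow.IsEvolvingTriple I g U)
    (hflow : NullFlow.IsModifiedRicciFlow I g U) :
    -- persistence, given the two properties at the initial time
    (NullFlow.IsConformalFoliationOn (g 0) (U 0) univ →
      NullFlow.IsIntegrableComplementOn (g 0) (U 0) univ →
      ∀ t ∈ I, 0 ≤ t → (∀ s ∈ Icc 0 t, ∀ x : M, NullFlow.RhoNeZero g U s x) →
        NullFlow.IsConformalFoliationOn (g t) (U t) (NullFlow.reached U t) ∧
        NullFlow.IsIntegrableComplementOn (g t) (U t) (NullFlow.reached U t)) ∧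
    -- the integral curves of `∂_t + U` are null geodesics
    (∀ J : Set ℝ, IsOpen J → ∀ γ : ℝ → ℝ × M,
      IsMIntegralCurveOn (I := 𝓘(ℝ, ℝ).prod (𝓡 3)) γ (NullFlow.nullField U) J →
      (∀ s ∈ J, (γ s).1 ∈ I ∧ NullFlow.NuNeZero g U (γ s).1 (γ s).2) →
      NullFlow.IsNullGeodesicOn g γ J) := by
  refine ⟨fun ⟨a, ha⟩ hint t ht ht0 hρ => ?_,
    fun J hJ γ hγ hν => hflow.isNullGeodesicOn htriple hJ hγ hν⟩
  have hinit (x : M) : NullFlow.IsConformalIntegrableAt (g 0) (U 0) x :=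
    ⟨⟨a, fun y _ => ha y (mem_univ y)⟩, fun y _ => hint y (mem_univ y)⟩
  have hreached (x : M) (hx : x ∈ NullFlow.reached U t) :
      NullFlow.IsConformalIntegrableAt (g t) (U t) x := by
    obtain ⟨γ, hγ, hγ0, hγt⟩ := hx
    have hfst {s : ℝ} (hs : s ∈ Icc 0 t) : (γ s).1 = s :=
      NullFlow.fst_eq_of_isMIntegralCurveOn hγ hγ0 hs
    have hend := hflow.isConformalIntegrableAt_of_isMIntegralCurveOn htriple hγ
      (fun s hs => (hfst hs).symm ▸ hI.out h0 ht hs)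
      (fun s hs => (hfst (Ico_subset_Icc_self hs)).symm ▸ hρ s (Ico_subset_Icc_self hs) _)
      (hγ0.symm ▸ hinit _) (right_mem_Icc.2 ht0)
    rwa [hγt] at hend
  choose! b hb using fun x hx => (hreached x hx).1
  exact ⟨⟨fun x => b x x, fun x hx => hb x hx x rfl⟩, fun x hx => (hreached x hx).2 x rfl⟩
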